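/- **Setting.** An *$L$-density* is a probability measure $\mathsf a$ on $[-\infty,+\infty]$ satisfying the symmetry condition $\mathsf a(-x)=e^{-x}\mathsf a(x)$ (in particular it has no mass at $-\infty$); such measures represent binary-input memoryless output-symmetric (BMS) channels, $\mathsf a$ being the law of the log-likelihood ratio when $+1$ is sent (and its reflection the law when $-1$ is sent). Its Bhattacharyya parameter is $B(\mathsf a)=\int e^{-x/2}\,\mathsf a(dx)$. Let $\lambda(x)=\sum_i\lambda_i x^{i-1}$ and $\rho(x)=\sum_i\rho_i x^{i-1}$ be degree distributions from the edge perspective: polynomials with nonnegative coefficients and $\lambda(1)=\rho(1)=1$. Let $\star$ be the convolution at variable nodes (the law of $X+Y$) and $\boxast$ the convolution at check nodes (the law of $2\,\mathrm{atanh}(\tanh(X/2)\tanh(Y/2))$), for independent $X,Y$. For a channel $\mathsf c$ the density evolution operator is $$T_{\mathsf c}(\mathsf a)=\mathsf c\star\lambda(\rho(\mathsf a)),\qquad \rho(\mathsf a)=\sum_i\rho_i\,\mathsf a^{\boxast(i-1)},\qquad \lambda(\mathsf b)=\sum_i\lambda_i\,\mathsf b^{\star(i-1)} .$$ A *fixed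 point density* for $\mathsf c$ is an $L$-density $\mathsf f$ with $T_{\mathsf c}(\mathsf f)=\mathsf f$. The *BP fixed point* for $\mathsf c$ is the weak limit, as $\ell\to\infty$, of $T_{\mathsf c}^{\ell}(\Delta_0)$, where $\Delta_0$ is the unit mass at $0$. **Lemma.** Let $\{\mathrm{BMS}(\mathtt h)\}_{\mathtt h}$, with a real parameter $\mathtt h$, be a family of BMS channels with $L$-densities $\mathsf c_{\mathtt h}$, ordered by physical degradation: for $\mathtt h_1\le\mathtt h_2$, $\mathrm{BMS}(\mathtt h_2)$ is $\mathrm{BMS}(\mathtt h_1)$ followed by a further channel. Write $B_{\mathtt h}=B(\mathsf c_{\mathtt h})$. Then: 1. For every $\mathtt h$ there is at most one fixed point density $\mathsf f_{\mathtt h}$ for $\mathsf c_{\mathtt h}$ such that $$B_{\mathtt h}\,\lambda'(1)\,\rho'\bigl(1-B(\mathsf f_{\mathtt h})^2\bigr)<1 .$$ 2. If such a density $\mathsf f_{\mathtt h}$ exists, it is the BP fixed point for $\mathsf c_{\mathtt h}$; that is, $T_{\mathsf c_{\mathtt h}}^{\ell}(\Delta_0)\to\mathsf f_{\mathtt h}$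 weakly as $\ell\to\infty$. 3. $B(\mathsf f_{\mathtt h})$ is Lipschitz continuous with respect to $B_{\mathtt h}$: for every $\delta>0$ there is a constant $C=C(\delta,\lambda,\rho)$, not depending on the channel family, such that if $\mathsf f_{\mathtt h_1}$, $\mathsf f_{\mathtt h_2}$ are fixed point densities for $\mathsf c_{\mathtt h_1}$, $\mathsf c_{\mathtt h_2}$ with $B_{\mathtt h_i}\,\lambda'(1)\,\rho'(1-B(\mathsf f_{\mathtt h_i})^2)\le 1-\delta$ for $i=1,2$, then $$|B(\mathsf f_{\mathtt h_1})-B(\mathsf f_{\mathtt h_2})|\le C\,|B_{\mathtt h_1}-B_{\mathtt h_2}| .$$ -/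

import Mathlib

open MeasureTheory ProbabilityTheory Filter Topology

noncomputable section

/-- A probability measure on the extended real line (log-likelihood ratios) obeying the symmetry
condition `a(-x) = e^{-x} a(x)`; these are exactly the `L`-densities of binary-input memoryless
output-symmetric channels. The point `x = -∞`, where `e^{-x} a(x)` has the indeterminate form
`∞ * 0`, is left out as a value of `x`; the case `x = +∞` says that `-∞` carries no mass. -/
def IsLDensity (a : ProbabilityMeasure EReal) : Prop :=
  ∀ s : Set EReal, MeasurableSet s → ⊥ ∉ s →
    (a : Measure EReal) ((fun x => -x) ⁻¹' s) = ∫⁻ x in s, EReal.exp (-x) ∂(a : Measure EReal)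

/-- The Bhattacharyya parameter `∫ e^{-x/2} a(dx)`. -/
def bhattacharyya (a : ProbabilityMeasure EReal) : ℝ :=
  (∫⁻ x, EReal.exp (-x / 2) ∂(a : Measure EReal)).toReal

/-- The unit mass at a log-likelihood ratio `x`; `x = 0` is the useless channel,
`x = +∞` the noiseless one. -/
def unitMass (x : EReal) : ProbabilityMeasure EReal :=
  ⟨Measure.dirac x, inferInstance⟩

/-- The law of `-X`, where `X` has law `a`. For a symmetric channel with `L`-density `a` it is the
law of the channel output when the input is `-1` (under input `+1` the law is `a`). -/
def reflect (a : ProbabilityMeasure EReal) : ProbabilityMeasure EReal :=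
  a.map (f := fun x => -x) continuous_neg.measurable.aemeasurable

/-- `IsDegraded b a`: the channel with `L`-density `b` is physically degraded with respect to the
channel with `L`-density `a`, i.e. it is that channel followed by a further channel `Q`. -/
def IsDegraded (b a : ProbabilityMeasure EReal) : Prop :=
  ∃ Q : Kernel EReal EReal, IsMarkovKernel Q ∧
    (b : Measure EReal) = (a : Measure EReal).bind Q ∧
    (reflect b : Measure EReal) = (reflect a : Measure EReal).bind Q

/-- A family `c h`, `h ∈ I`, of symmetric channels (given by `L`-densities) that is ordered by
physical degradation: the channel gets worse as `h` grows. -/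
structure IsDegradedFamily (I : Set ℝ) (c : ℝ → ProbabilityMeasure EReal) : Prop where
  isLDensity : ∀ h ∈ I, IsLDensity (c h)
  degraded : ∀ h₁ ∈ I, ∀ h₂ ∈ I, h₁ ≤ h₂ → IsDegraded (c h₂) (c h₁)

/-- A degree distribution from the edge perspective, `∑ i, p_i x^(i-1)`: the coefficient of `x^n`
is the fraction of edges attached to nodes of degree `n + 1`. -/
structure DegreeDistribution where
  poly : Polynomial ℝ
  coeff_nonneg : ∀ n, 0 ≤ poly.coeff n
  eval_one : poly.eval 1 = 1

/-- The mixture `∑ n, p_n g_n`. -/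
def DegreeDistribution.mix (p : DegreeDistribution) (g : ℕ → ProbabilityMeasure EReal) :
    ProbabilityMeasure EReal :=
  ⟨∑ n ∈ Finset.range (p.poly.natDegree + 1),
      ENNReal.ofReal (p.poly.coeff n) • (g n : Measure EReal), ⟨by
    have h := p.eval_one
    rw [Polynomial.eval_eq_sum_range] at h
    simp only [one_pow, mul_one] at h
    simp only [Measure.coe_finsetSum, Measure.coe_smul, Finset.sum_apply, Pi.smul_apply,
      measure_univ, smul_eq_mul, mul_one]
    rw [← ENNReal.ofReal_sum_of_nonneg (fun n _ => p.coeff_nonneg n), h, ENNReal.ofReal_one]⟩⟩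

/-- Convolution at a variable node: the law of `X + Y`, with `X`, `Y` independent. -/
def varConv (a b : ProbabilityMeasure EReal) : ProbabilityMeasure EReal :=
  (a.prod b).map (f := fun p => p.1 + p.2) (measurable_fst.add measurable_snd).aemeasurable

/-- `tanh (x / 2)` on the extended real line. -/
def tanhHalf (x : EReal) : ℝ :=
  if x = ⊤ then 1 else if x = ⊥ then -1 else Real.tanh (x.toReal / 2)

/-- The inverse of `tanhHalf` on `[-1, 1]`: `2 atanh y = log ((1 + y) / (1 - y))`, with values
`+∞` at `1` and `-∞` at `-1`. -/
def twoArtanh (y : ℝ) : EReal :=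
  ENNReal.log (ENNReal.ofReal (1 + y) / ENNReal.ofReal (1 - y))

theorem measurable_tanhHalf : Measurable tanhHalf := by
  unfold tanhHalf
  refine Measurable.ite (measurableSet_singleton _) measurable_const
    (Measurable.ite (measurableSet_singleton _) measurable_const ?_)
  simp only [Real.tanh_eq_sinh_div_cosh]
  have h : Measurable fun x : EReal => x.toReal / 2 := measurable_ereal_toReal.div_const 2
  exact (Real.continuous_sinh.measurable.comp h).div (Real.continuous_cosh.measurable.comp h)

theorem measurable_twoArtanh : Measurable twoArtanh := by
  unfold twoArtanh
  exact ENNReal.continuous_log.measurable.comp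
    ((measurable_const.add measurable_id).ennreal_ofReal.div
      (measurable_const.sub measurable_id).ennreal_ofReal)

/-- Convolution at a check node: the law of `2 atanh (tanh (X / 2) tanh (Y / 2))`, with `X`, `Y`
independent. -/
def checkConv (a b : ProbabilityMeasure EReal) : ProbabilityMeasure EReal :=
  (a.prod b).map (f := fun p => twoArtanh (tanhHalf p.1 * tanhHalf p.2))
    (measurable_twoArtanh.comp ((measurable_tanhHalf.comp measurable_fst).mul
      (measurable_tanhHalf.comp measurable_snd))).aemeasurable

/-- The `n`-fold variable-node convolution of `a` with itself. -/
def varPow (a : ProbabilityMeasure EReal) : ℕ → ProbabilityMeasure EReal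
  | 0 => unitMass 0
  | n + 1 => varConv a (varPow a n)

/-- The `n`-fold check-node convolution of `a` with itself. -/
def checkPow (a : ProbabilityMeasure EReal) : ℕ → ProbabilityMeasure EReal
  | 0 => unitMass ⊤
  | n + 1 => checkConv a (checkPow a n)

/-- The density evolution operator `a ↦ c ⋆ λ(ρ(a))` for the channel `c`, where powers are
variable-node convolutions in `λ` and check-node convolutions in `ρ`. -/
def densityEvolution (lam rho : DegreeDistribution) (c a : ProbabilityMeasure EReal) :
    ProbabilityMeasure EReal :=
  varConv c (lam.mix (varPow (rho.mix (checkPow a))))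

/-- `f` is a fixed point density of density evolution for the channel `c`. -/
structure IsFixedPointDensity (lam rho : DegreeDistribution) (c f : ProbabilityMeasure EReal) :
    Prop where
  isLDensity : IsLDensity f
  fixed : densityEvolution lam rho c f = f

/-- `f` is the BP fixed point for the channel `c`: the weak limit, as the number of iterations
grows, of density evolution started from the useless density. -/
def IsBPFixedPoint (lam rho : DegreeDistribution) (c f : ProbabilityMeasure EReal) : Prop :=
  Tendsto (fun l : ℕ => (densityEvolution lam rho c)^[l] (unitMass 0)) atTop (𝓝 f)

/-- The quantity `B(c) λ'(1) ρ'(1 - B(f)^2)`. -/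
def uniquenessFactor (lam rho : DegreeDistribution) (c f : ProbabilityMeasure EReal) : ℝ :=
  bhattacharyya c * lam.poly.derivative.eval 1 *
    rho.poly.derivative.eval (1 - bhattacharyya f ^ 2)

end

/-!
Channels are compared by the overlap of their two output laws. Physical degradation can only
increase the overlap, and density evolution is monotone for the resulting order: at variable nodes
this is read off from the overlap itself, and at check nodes from the expectations `E max(τ, |T|)`
of the soft bit `T = tanh (X / 2)`, which determine the order and see the check node as a product.
It follows that the moments `E T^{2k}` are antitone for this order.

By the symmetry of `a`, `B(a) = E √(1 - T²)`, so `1 - B(a)` is a series in the moments `E T^{2k}`,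
`k ≥ 1`, with positive coefficients. A check node raises each moment to a power, and every moment is
at most `E T² ≤ 1 - B(a)²`. Hence, by the mean value inequality, density evolution shrinks the
difference `B(b) - B(f)` at least by the factor `B(c) λ'(1) ρ'(1 - B(f)²)` as long as the moments of
`b` are dominated by those of `f`. This is the case for all iterates started from `Δ₀`, which
therefore converge to a fixed point `f` with factor less than `1`, first in `B`, then in every
moment, then weakly, since the soft bit lives in `[-1, 1]`. The Lipschitz bound comes from comparing
`f₁ = T_{c₁}(f₁)` with `f₂ = T_{c₂}(f₂)` through `T_{c₁}(f₂)`.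
-/

noncomputable section

variable {a b c : ProbabilityMeasure EReal}

/-! ### The soft bit `tanh (x / 2)` -/

@[simp] theorem tanhHalf_coe (x : ℝ) : tanhHalf x = Real.tanh (x / 2) := by simp [tanhHalf]

@[simp] theorem tanhHalf_top : tanhHalf ⊤ = 1 := by simp [tanhHalf]

@[simp] theorem tanhHalf_bot : tanhHalf ⊥ = -1 := by simp [tanhHalf]

@[simp] theorem tanhHalf_zero : tanhHalf 0 = 0 := by
  simpa using tanhHalf_coe 0

theorem tanhHalf_neg (x : EReal) : tanhHalf (-x) = -tanhHalf x := by
  induction x with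
  | bot => simp
  | top => simp
  | coe x => rw [← EReal.coe_neg, tanhHalf_coe, tanhHalf_coe, neg_div, Real.tanh_neg]

theorem abs_tanhHalf_le_one (x : EReal) : |tanhHalf x| ≤ 1 := by
  induction x with
  | bot => simp
  | top => simp
  | coe x => simpa using (Real.abs_tanh_lt_one (x / 2)).le

theorem tanhHalf_mem_Icc (x : EReal) : tanhHalf x ∈ Set.Icc (-1) 1 :=
  abs_le.1 (abs_tanhHalf_le_one x)

theorem abs_tanhHalf_pow_le_one (x : EReal) (n : ℕ) : |tanhHalf x ^ n| ≤ 1 := by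
  rw [abs_pow]
  exact pow_le_one₀ (abs_nonneg _) (abs_tanhHalf_le_one x)

theorem tanhHalf_sq_le_one (x : EReal) : tanhHalf x ^ 2 ≤ 1 :=
  (sq_le_one_iff_abs_le_one _).2 (abs_tanhHalf_le_one x)

@[simp] theorem twoArtanh_one : twoArtanh 1 = ⊤ := by simp [twoArtanh, ENNReal.div_zero]

@[simp] theorem twoArtanh_neg_one : twoArtanh (-1) = ⊥ := by simp [twoArtanh]

theorem twoArtanh_of_mem_Ioo {y : ℝ} (hy : y ∈ Set.Ioo (-1) 1) :
    twoArtanh y = (2 * Real.artanh y : ℝ) := by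
  obtain ⟨h₁, h₂⟩ := hy
  rw [twoArtanh, ← ENNReal.ofReal_div_of_pos (by linarith),
    ENNReal.log_ofReal_of_pos (div_pos (by linarith) (by linarith)),
    Real.artanh_eq_half_log ⟨h₁.le, h₂.le⟩]
  ring_nf

theorem tanhHalf_twoArtanh {y : ℝ} (hy : y ∈ Set.Icc (-1) 1) : tanhHalf (twoArtanh y) = y := by
  obtain ⟨h₁, h₂⟩ := hy
  rcases h₁.eq_or_lt with rfl | h₁
  · simp
  rcases h₂.eq_or_lt with rfl | h₂
  · simp
  rw [twoArtanh_of_mem_Ioo ⟨h₁, h₂⟩, tanhHalf_coe, mul_div_cancel_left₀ _ two_ne_zero,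
    Real.tanh_artanh ⟨h₁, h₂⟩]

theorem twoArtanh_tanhHalf (x : EReal) : twoArtanh (tanhHalf x) = x := by
  induction x with
  | bot => simp
  | top => simp
  | coe x =>
    rw [tanhHalf_coe, twoArtanh_of_mem_Ioo (abs_lt.1 (Real.abs_tanh_lt_one _)), Real.artanh_tanh,
      mul_div_cancel₀ _ two_ne_zero]

theorem continuous_twoArtanh : Continuous twoArtanh := by
  refine ENNReal.continuous_log.comp (continuous_iff_continuousAt.2 fun y => ?_)
  refine ENNReal.Tendsto.div ?_ ?_ ?_ ?_
  · exact (ENNReal.continuous_ofReal.comp (continuous_const.add continuous_id)).continuousAt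
  · rw [ne_eq, ne_eq, ENNReal.ofReal_eq_zero, ENNReal.ofReal_eq_zero, not_le, not_le]
    by_contra! h
    linarith
  · exact (ENNReal.continuous_ofReal.comp (continuous_const.sub continuous_id)).continuousAt
  · exact Or.inl ENNReal.ofReal_ne_top

/-- Being a continuous surjection of compact Hausdorff spaces, `twoArtanh` is a quotient map. -/
theorem continuous_tanhHalf : Continuous tanhHalf := by
  have hquot : IsQuotientMap fun y : Set.Icc (-1 : ℝ) 1 => twoArtanh y :=
    .of_surjective_continuous (fun x => ⟨⟨tanhHalf x, tanhHalf_mem_Icc x⟩, twoArtanh_tanhHalf x⟩)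
      (continuous_twoArtanh.comp continuous_subtype_val)
  rw [hquot.continuous_iff]
  exact continuous_subtype_val.congr fun y => (tanhHalf_twoArtanh y.2).symm

/-- The log-likelihood ratio `2 atanh (tanh (x / 2) tanh (y / 2))` sent by a check node that
receives `x` and `y`. -/
def checkNode (x y : EReal) : EReal := twoArtanh (tanhHalf x * tanhHalf y)

@[simp] theorem tanhHalf_checkNode (x y : EReal) :
    tanhHalf (checkNode x y) = tanhHalf x * tanhHalf y :=
  tanhHalf_twoArtanh <| abs_le.1 <| by
    rw [abs_mul]
    exact mul_le_one₀ (abs_tanhHalf_le_one x) (abs_nonneg _) (abs_tanhHalf_le_one y)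

theorem checkNode_comm (x y : EReal) : checkNode x y = checkNode y x := by
  rw [checkNode, mul_comm, checkNode]

theorem checkNode_neg_right (x y : EReal) : checkNode x (-y) = -checkNode x y := by
  rw [← twoArtanh_tanhHalf (-checkNode x y), tanhHalf_neg, tanhHalf_checkNode, checkNode,
    tanhHalf_neg, mul_neg]

theorem checkNode_neg_left (x y : EReal) : checkNode (-x) y = -checkNode x y := by
  rw [checkNode_comm, checkNode_neg_right, checkNode_comm]

theorem measurable_checkNode : Measurable fun p : EReal × EReal => checkNode p.1 p.2 :=
  measurable_twoArtanh.comp ((measurable_tanhHalf.comp measurable_fst).mul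
    (measurable_tanhHalf.comp measurable_snd))

theorem measurable_checkNode_right (x : EReal) : Measurable (checkNode x) :=
  measurable_twoArtanh.comp (measurable_tanhHalf.const_mul _)

/-- `1 + tanh (x / 2)`, twice the posterior probability of the input `+1` when the two inputs are
equally likely and the log-likelihood ratio is `x`; for the input `-1` it is
`posteriorWeight (-x)`. -/
def posteriorWeight (x : EReal) : ENNReal := ENNReal.ofReal (1 + tanhHalf x)

theorem posteriorWeight_neg (x : EReal) :
    posteriorWeight (-x) = ENNReal.ofReal (1 - tanhHalf x) := by
  rw [posteriorWeight, tanhHalf_neg, sub_eq_add_neg]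

@[fun_prop] theorem measurable_posteriorWeight : Measurable posteriorWeight :=
  (measurable_const.add measurable_tanhHalf).ennreal_ofReal

theorem posteriorWeight_ne_top (x : EReal) : posteriorWeight x ≠ ⊤ := ENNReal.ofReal_ne_top

@[simp] theorem posteriorWeight_bot : posteriorWeight ⊥ = 0 := by simp [posteriorWeight]

theorem posteriorWeight_ne_zero {x : EReal} (hx : x ≠ ⊥) : posteriorWeight x ≠ 0 := by
  rw [posteriorWeight, ENNReal.ofReal_ne_zero_iff]
  induction x with
  | bot => exact absurd rfl hx
  | top => simp
  | coe x =>
    rw [tanhHalf_coe]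
    linarith [(abs_lt.1 (Real.abs_tanh_lt_one (x / 2))).1]

theorem posteriorWeight_add_posteriorWeight_neg (x : EReal) :
    posteriorWeight x + posteriorWeight (-x) = 2 := by
  obtain ⟨h₁, h₂⟩ := tanhHalf_mem_Icc x
  rw [posteriorWeight_neg, posteriorWeight, ← ENNReal.ofReal_add (by linarith) (by linarith)]
  norm_num

theorem posteriorWeight_mul_posteriorWeight_add (x y : EReal) :
    posteriorWeight x * posteriorWeight y + posteriorWeight (-x) * posteriorWeight (-y) =
      2 * posteriorWeight (checkNode x y) := by
  obtain ⟨hx₁, hx₂⟩ := tanhHalf_mem_Icc x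
  obtain ⟨hy₁, hy₂⟩ := tanhHalf_mem_Icc y
  rw [posteriorWeight_neg, posteriorWeight_neg, posteriorWeight, posteriorWeight, posteriorWeight,
    tanhHalf_checkNode, ← ENNReal.ofReal_mul (by linarith), ← ENNReal.ofReal_mul (by linarith),
    ← ENNReal.ofReal_add (mul_nonneg (by linarith) (by linarith))
      (mul_nonneg (by linarith) (by linarith)), ← ENNReal.ofReal_ofNat 2,
    ← ENNReal.ofReal_mul zero_le_two]
  ring_nf

theorem exp_neg_mul_one_add_tanh (u : ℝ) :
    Real.exp (-u) * (1 + Real.tanh u) = (Real.cosh u)⁻¹ := by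
  have hcosh := (Real.cosh_pos u).ne'
  rw [← Real.cosh_sub_sinh, Real.tanh_eq_sinh_div_cosh]
  field_simp
  linarith [Real.cosh_sq u]

theorem posteriorWeight_mul_exp_neg {x : EReal} (hx : x ≠ ⊥) :
    posteriorWeight x * EReal.exp (-x) = posteriorWeight (-x) := by
  induction x with
  | bot => exact absurd rfl hx
  | top => simp
  | coe x =>
    have h₁ := exp_neg_mul_one_add_tanh (x / 2)
    have h₂ := exp_neg_mul_one_add_tanh (-(x / 2))
    rw [Real.cosh_neg, Real.tanh_neg, neg_neg, ← h₁] at h₂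
    rw [posteriorWeight_neg, posteriorWeight, ← EReal.coe_neg, EReal.exp_coe,
      ← ENNReal.ofReal_mul (by linarith [(tanhHalf_mem_Icc x).1]), tanhHalf_coe]
    congr 1
    have hexp : Real.exp (-x) = Real.exp (-(x / 2)) * Real.exp (-(x / 2)) := by
      rw [← Real.exp_add]
      ring_nf
    calc (1 + Real.tanh (x / 2)) * Real.exp (-x)
        = Real.exp (-(x / 2)) * (Real.exp (x / 2) * (1 + -Real.tanh (x / 2))) := by
          rw [h₂, hexp]
          ring
      _ = 1 - Real.tanh (x / 2) := by
          rw [← mul_assoc, ← Real.exp_add, neg_add_cancel, Real.exp_zero, one_mul, sub_eq_add_neg]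

theorem posteriorWeight_mul_exp_neg_half (x : EReal) :
    posteriorWeight x * EReal.exp (-x / 2) = ENNReal.ofReal √(1 - tanhHalf x ^ 2) := by
  have htwo : (2 : EReal) = (2 : ℝ) := rfl
  induction x with
  | bot => simp
  | top =>
    rw [EReal.neg_top, htwo, EReal.bot_div_of_pos_ne_top (by norm_num) (EReal.coe_ne_top 2)]
    simp
  | coe x =>
    rw [htwo, ← EReal.coe_neg, ← EReal.coe_div, EReal.exp_coe, posteriorWeight,
      ← ENNReal.ofReal_mul (by linarith [(tanhHalf_mem_Icc x).1]), tanhHalf_coe, mul_comm, neg_div,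
      exp_neg_mul_one_add_tanh, Real.tanh_eq_sinh_div_cosh]
    congr 1
    rw [eq_comm, Real.sqrt_eq_iff_mul_self_eq_of_pos (by positivity)]
    field_simp
    linarith [Real.cosh_sq (x / 2)]

/-! ### Symmetric densities -/

@[fun_prop] theorem measurable_exp_neg_ereal : Measurable fun x : EReal => EReal.exp (-x) :=
  continuous_neg.measurable.ereal_exp

theorem IsLDensity.ae_ne_bot (ha : IsLDensity a) : ∀ᵐ x ∂(a : Measure EReal), x ≠ ⊥ := by
  have h := ha {⊤} (measurableSet_singleton _) (by simp)
  have hpre : (fun x : EReal => -x) ⁻¹' {⊤} = {⊥} := by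
    ext x
    simp
  rw [ae_iff]
  simpa [hpre] using h

theorem IsLDensity.restrict_reflect (ha : IsLDensity a) :
    (reflect a : Measure EReal).restrict {⊥}ᶜ =
      (a : Measure EReal).withDensity fun x => EReal.exp (-x) := by
  have hbot : MeasurableSet ({⊥}ᶜ : Set EReal) := (measurableSet_singleton _).compl
  ext s hs
  calc (reflect a : Measure EReal).restrict {⊥}ᶜ s
      = ∫⁻ x in s ∩ {⊥}ᶜ, EReal.exp (-x) ∂a := by
        rw [Measure.restrict_apply hs, reflect, ProbabilityMeasure.toMeasure_map,
          Measure.map_apply measurable_neg (hs.inter hbot), ha _ (hs.inter hbot) (by simp)]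
    _ = ∫⁻ x in s, EReal.exp (-x) ∂a := by
        refine setLIntegral_congr ?_
        filter_upwards [ha.ae_ne_bot] with x hx
        exact propext (and_iff_left hx)
    _ = _ := (withDensity_apply _ hs).symm

theorem lintegral_reflect (a : ProbabilityMeasure EReal) {f : EReal → ENNReal}
    (hf : Measurable f) : ∫⁻ x, f x ∂(reflect a) = ∫⁻ x, f (-x) ∂a := by
  rw [reflect, ProbabilityMeasure.toMeasure_map, lintegral_map hf measurable_neg]

theorem isLDensity_iff_lintegral_neg : IsLDensity a ↔ ∀ f : EReal → ENNReal, Measurable f →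
    f ⊥ = 0 → ∫⁻ x, f (-x) ∂a = ∫⁻ x, f x * EReal.exp (-x) ∂a := by
  constructor
  · intro ha f hf hf0
    have hbot : MeasurableSet ({⊥}ᶜ : Set EReal) := (measurableSet_singleton _).compl
    have hind : Set.indicator {⊥}ᶜ f = f :=
      Set.indicator_eq_self.2 fun x hx h => hx (h ▸ hf0)
    calc ∫⁻ x, f (-x) ∂a = ∫⁻ x in {⊥}ᶜ, f x ∂(reflect a) := by
          rw [← lintegral_indicator hbot, hind, lintegral_reflect a hf]
      _ = ∫⁻ x, f x * EReal.exp (-x) ∂a := by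
          rw [ha.restrict_reflect,
            lintegral_withDensity_eq_lintegral_mul _ measurable_exp_neg_ereal hf]
          simp only [Pi.mul_apply, mul_comm]
  · intro h s hs hbot
    have hneg := h (s.indicator 1) (measurable_one.indicator hs) (Set.indicator_of_notMem hbot _)
    calc (a : Measure EReal) ((fun x => -x) ⁻¹' s) = ∫⁻ x, s.indicator 1 (-x) ∂a := by
          rw [← lintegral_indicator_one (measurable_neg hs)]
          rfl
      _ = ∫⁻ x in s, EReal.exp (-x) ∂a := by
          rw [hneg, ← lintegral_indicator hs]
          refine lintegral_congr fun x => ?_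
          by_cases hx : x ∈ s <;> simp [hx]

theorem IsLDensity.lintegral_neg (ha : IsLDensity a) {f : EReal → ENNReal} (hf : Measurable f)
    (hf0 : f ⊥ = 0) : ∫⁻ x, f (-x) ∂a = ∫⁻ x, f x * EReal.exp (-x) ∂a :=
  isLDensity_iff_lintegral_neg.1 ha f hf hf0

theorem IsLDensity.lintegral_neg_mul_posteriorWeight (ha : IsLDensity a) {f : EReal → ENNReal}
    (hf : Measurable f) :
    ∫⁻ x, f (-x) * posteriorWeight (-x) ∂a = ∫⁻ x, f x * posteriorWeight (-x) ∂a := by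
  rw [ha.lintegral_neg (f := fun x => f x * posteriorWeight x) (by fun_prop) (by simp)]
  refine lintegral_congr_ae ?_
  filter_upwards [ha.ae_ne_bot] with x hx
  rw [mul_assoc, posteriorWeight_mul_exp_neg hx]

theorem isLDensity_of_lintegral_neg_mul_posteriorWeight
    (h : ∀ f : EReal → ENNReal, Measurable f →
      ∫⁻ x, f (-x) * posteriorWeight (-x) ∂a = ∫⁻ x, f x * posteriorWeight (-x) ∂a) :
    IsLDensity a := by
  refine isLDensity_iff_lintegral_neg.2 fun f hf hf0 => ?_
  have hcancel : ∀ x, f x / posteriorWeight x * posteriorWeight x = f x := fun x => by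
    rcases eq_or_ne x ⊥ with rfl | hx
    · simp [hf0]
    · exact ENNReal.div_mul_cancel (posteriorWeight_ne_zero hx) (posteriorWeight_ne_top x)
  have hexp : ∀ x, f x / posteriorWeight x * posteriorWeight (-x) = f x * EReal.exp (-x) :=
    fun x => by
      rcases eq_or_ne x ⊥ with rfl | hx
      · simp [hf0]
      · rw [← posteriorWeight_mul_exp_neg hx, ← mul_assoc, hcancel]
  simpa only [hcancel, hexp] using
    h (fun x => f x / posteriorWeight x) (hf.div measurable_posteriorWeight)

theorem IsLDensity.two_mul_lintegral (ha : IsLDensity a) {f : EReal → ENNReal}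
    (hf : Measurable f) : 2 * ∫⁻ x, f x ∂a =
      ∫⁻ x, (f x * posteriorWeight x + f (-x) * posteriorWeight (-x)) ∂a := by
  have hm : Measurable fun x => f x * posteriorWeight x := by fun_prop
  rw [lintegral_add_left hm, ha.lintegral_neg_mul_posteriorWeight hf, ← lintegral_add_left hm,
    ← lintegral_const_mul _ hf]
  simp only [← mul_add, posteriorWeight_add_posteriorWeight_neg, mul_comm]

/-! ### Convolutions and mixtures -/

theorem measurable_add_ereal : Measurable fun p : EReal × EReal => p.1 + p.2 :=
  measurable_fst.add measurable_snd

theorem lintegral_varConv (a b : ProbabilityMeasure EReal) {f : EReal → ENNReal}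
    (hf : Measurable f) : ∫⁻ z, f z ∂(varConv a b) = ∫⁻ x, ∫⁻ y, f (x + y) ∂b ∂a := by
  rw [varConv, ProbabilityMeasure.toMeasure_map, lintegral_map hf measurable_add_ereal,
    ProbabilityMeasure.toMeasure_prod]
  exact lintegral_prod _ (hf.comp measurable_add_ereal).aemeasurable

theorem lintegral_checkConv (a b : ProbabilityMeasure EReal) {f : EReal → ENNReal}
    (hf : Measurable f) :
    ∫⁻ z, f z ∂(checkConv a b) = ∫⁻ x, ∫⁻ y, f (checkNode x y) ∂b ∂a := by
  rw [checkConv, ProbabilityMeasure.toMeasure_map]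
  refine (lintegral_map hf measurable_checkNode).trans ?_
  rw [ProbabilityMeasure.toMeasure_prod]
  exact lintegral_prod _ (hf.comp measurable_checkNode).aemeasurable

theorem varConv_comm (a b : ProbabilityMeasure EReal) : varConv a b = varConv b a := by
  refine Subtype.ext (Measure.ext_of_lintegral _ fun f hf => ?_)
  refine (lintegral_varConv a b hf).trans (.trans ?_ (lintegral_varConv b a hf).symm)
  refine (lintegral_lintegral_swap (f := fun x y => f (x + y))
    (hf.comp measurable_add_ereal).aemeasurable).trans ?_
  simp only [add_comm]

theorem checkConv_comm (a b : ProbabilityMeasure EReal) : checkConv a b = checkConv b a := by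
  refine Subtype.ext (Measure.ext_of_lintegral _ fun f hf => ?_)
  refine (lintegral_checkConv a b hf).trans (.trans ?_ (lintegral_checkConv b a hf).symm)
  refine (lintegral_lintegral_swap (f := fun x y => f (checkNode x y))
    (hf.comp measurable_checkNode).aemeasurable).trans ?_
  simp only [checkNode_comm]

theorem DegreeDistribution.coe_mix (p : DegreeDistribution) (g : ℕ → ProbabilityMeasure EReal) :
    (p.mix g : Measure EReal) = ∑ n ∈ Finset.range (p.poly.natDegree + 1),
      ENNReal.ofReal (p.poly.coeff n) • (g n : Measure EReal) := rfl

theorem DegreeDistribution.lintegral_mix (p : DegreeDistribution)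
    (g : ℕ → ProbabilityMeasure EReal) (f : EReal → ENNReal) :
    ∫⁻ x, f x ∂(p.mix g) = ∑ n ∈ Finset.range (p.poly.natDegree + 1),
      ENNReal.ofReal (p.poly.coeff n) * ∫⁻ x, f x ∂(g n) := by
  simp only [p.coe_mix, lintegral_finsetSum_measure, lintegral_smul_measure, smul_eq_mul]

theorem lintegral_unitMass (x : EReal) (f : EReal → ENNReal) : ∫⁻ y, f y ∂(unitMass x) = f x :=
  lintegral_dirac x f

theorem isLDensity_unitMass_zero : IsLDensity (unitMass 0) :=
  isLDensity_iff_lintegral_neg.2 fun f _ _ => by simp [lintegral_unitMass]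

theorem isLDensity_unitMass_top : IsLDensity (unitMass ⊤) :=
  isLDensity_iff_lintegral_neg.2 fun f _ hf0 => by simp [lintegral_unitMass, hf0]

theorem DegreeDistribution.isLDensity_mix (p : DegreeDistribution)
    {g : ℕ → ProbabilityMeasure EReal} (hg : ∀ n, IsLDensity (g n)) : IsLDensity (p.mix g) :=
  isLDensity_iff_lintegral_neg.2 fun f hf hf0 => by
    simp only [p.lintegral_mix, (hg _).lintegral_neg hf hf0]

theorem IsLDensity.lintegral_lintegral_congr (ha : IsLDensity a) (hb : IsLDensity b)
    {F G : EReal → EReal → ENNReal} (h : ∀ x y, x ≠ ⊥ → y ≠ ⊥ → F x y = G x y) :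
    ∫⁻ x, ∫⁻ y, F x y ∂b ∂a = ∫⁻ x, ∫⁻ y, G x y ∂b ∂a := by
  refine lintegral_congr_ae ?_
  filter_upwards [ha.ae_ne_bot] with x hx
  refine lintegral_congr_ae ?_
  filter_upwards [hb.ae_ne_bot] with y hy
  exact h x y hx hy

theorem neg_add_of_ne_bot {x y : EReal} (hx : x ≠ ⊥) (hy : y ≠ ⊥) : -(x + y) = -x + -y := by
  rw [EReal.neg_add (Or.inl hx) (Or.inr hy), sub_eq_add_neg]

protected theorem IsLDensity.varConv (ha : IsLDensity a) (hb : IsLDensity b) :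
    IsLDensity (varConv a b) := by
  refine isLDensity_iff_lintegral_neg.2 fun f hf hf0 => ?_
  have hF : Measurable fun p : EReal × EReal => f (p.1 + p.2) * EReal.exp (-p.2) :=
    (hf.comp measurable_add_ereal).mul (measurable_exp_neg_ereal.comp measurable_snd)
  calc ∫⁻ z, f (-z) ∂(varConv a b)
      = ∫⁻ x, ∫⁻ y, f (-x + -y) ∂b ∂a := by
        rw [lintegral_varConv a b (f := fun z => f (-z)) (hf.comp measurable_neg)]
        exact ha.lintegral_lintegral_congr hb fun x y hx hy => by rw [neg_add_of_ne_bot hx hy]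
    _ = ∫⁻ x, ∫⁻ y, f (-x + y) * EReal.exp (-y) ∂b ∂a :=
        lintegral_congr fun x => hb.lintegral_neg (f := fun y => f (-x + y))
          (hf.comp (measurable_const.add measurable_id)) (by simp [hf0])
    _ = ∫⁻ x, (∫⁻ y, f (x + y) * EReal.exp (-y) ∂b) * EReal.exp (-x) ∂a :=
        ha.lintegral_neg (f := fun x => ∫⁻ y, f (x + y) * EReal.exp (-y) ∂b)
          hF.lintegral_prod_right' (by simp [hf0])
    _ = ∫⁻ x, ∫⁻ y, f (x + y) * EReal.exp (-y) * EReal.exp (-x) ∂b ∂a :=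
        lintegral_congr fun x => (lintegral_mul_const _ (hF.comp measurable_prodMk_left)).symm
    _ = ∫⁻ z, f z * EReal.exp (-z) ∂(varConv a b) := by
        rw [lintegral_varConv a b (f := fun z => f z * EReal.exp (-z))
          (hf.mul measurable_exp_neg_ereal)]
        refine ha.lintegral_lintegral_congr hb fun x y hx hy => ?_
        rw [neg_add_of_ne_bot hx hy, EReal.exp_add, mul_assoc, mul_comm (EReal.exp (-y))]

theorem two_mul_posteriorWeight_neg_checkNode (x y : EReal) :
    2 * posteriorWeight (-checkNode x y) =
      posteriorWeight x * posteriorWeight (-y) + posteriorWeight (-x) * posteriorWeight y := by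
  rw [← checkNode_neg_right, ← posteriorWeight_mul_posteriorWeight_add, neg_neg]

theorem two_mul_lintegral_checkConv_mul_posteriorWeight (a b : ProbabilityMeasure EReal)
    {f : EReal → ENNReal} (hf : Measurable f) :
    2 * ∫⁻ z, f z * posteriorWeight (-z) ∂(checkConv a b) =
      ∫⁻ x, posteriorWeight x * ∫⁻ y, f (checkNode x y) * posteriorWeight (-y) ∂b ∂a +
      ∫⁻ x, (∫⁻ y, f (checkNode x y) * posteriorWeight y ∂b) * posteriorWeight (-x) ∂a := by
  have hw := measurable_posteriorWeight
  have hF : Measurable fun p : EReal × EReal => f (checkNode p.1 p.2) :=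
    hf.comp measurable_checkNode
  have hFm : Measurable fun p : EReal × EReal => f (checkNode p.1 p.2) * posteriorWeight (-p.2) :=
    hF.mul (hw.comp measurable_snd.neg)
  have hm : Measurable fun x =>
      posteriorWeight x * ∫⁻ y, f (checkNode x y) * posteriorWeight (-y) ∂b :=
    hw.mul hFm.lintegral_prod_right'
  rw [lintegral_checkConv a b (f := fun z => f z * posteriorWeight (-z))
    (hf.mul (hw.comp measurable_neg)), ← lintegral_const_mul' _ _ ENNReal.ofNat_ne_top,
    ← lintegral_add_left hm]
  refine lintegral_congr fun x => ?_
  have hFx : Measurable fun y => f (checkNode x y) := hf.comp (measurable_checkNode_right x)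
  have hFxm : Measurable fun y => f (checkNode x y) * posteriorWeight (-y) :=
    hFx.mul (hw.comp measurable_neg)
  have hFxp : Measurable fun y => f (checkNode x y) * posteriorWeight y := hFx.mul hw
  rw [← lintegral_const_mul' _ _ ENNReal.ofNat_ne_top, ← lintegral_mul_const _ hFxp,
    ← lintegral_const_mul _ hFxm, ← lintegral_add_left (hFxm.const_mul _)]
  refine lintegral_congr fun y => ?_
  rw [mul_left_comm, two_mul_posteriorWeight_neg_checkNode]
  ring

protected theorem IsLDensity.checkConv (ha : IsLDensity a) (hb : IsLDensity b) :
    IsLDensity (checkConv a b) := by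
  refine isLDensity_of_lintegral_neg_mul_posteriorWeight fun f hf => ?_
  have hF : Measurable fun p : EReal × EReal => f (checkNode p.1 p.2) :=
    hf.comp measurable_checkNode
  have hFm : Measurable fun p : EReal × EReal => f (checkNode p.1 p.2) * posteriorWeight p.2 :=
    hF.mul (measurable_posteriorWeight.comp measurable_snd)
  have hG : Measurable fun x => ∫⁻ y, f (checkNode x y) * posteriorWeight y ∂b :=
    hFm.lintegral_prod_right'
  refine (ENNReal.mul_right_inj two_ne_zero ENNReal.ofNat_ne_top).1 ?_
  rw [two_mul_lintegral_checkConv_mul_posteriorWeight a b hf,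
    two_mul_lintegral_checkConv_mul_posteriorWeight a b (f := fun z => f (-z))
      (hf.comp measurable_neg)]
  congr 1
  · refine lintegral_congr fun x => ?_
    have hFx : Measurable fun y => f (checkNode x y) := hf.comp (measurable_checkNode_right x)
    simp only [← checkNode_neg_right]
    rw [hb.lintegral_neg_mul_posteriorWeight hFx]
  · simp only [← checkNode_neg_left]
    exact ha.lintegral_neg_mul_posteriorWeight hG

protected theorem IsLDensity.varPow (ha : IsLDensity a) : ∀ n, IsLDensity (varPow a n)
  | 0 => isLDensity_unitMass_zero
  | n + 1 => ha.varConv (ha.varPow n)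

protected theorem IsLDensity.checkPow (ha : IsLDensity a) : ∀ n, IsLDensity (checkPow a n)
  | 0 => isLDensity_unitMass_top
  | n + 1 => ha.checkConv (ha.checkPow n)

protected theorem IsLDensity.densityEvolution (lam rho : DegreeDistribution) (hc : IsLDensity c)
    (ha : IsLDensity a) : IsLDensity (densityEvolution lam rho c a) :=
  hc.varConv (lam.isLDensity_mix (rho.isLDensity_mix ha.checkPow).varPow)

/-! ### The order by overlap -/

/-- The overlap (common mass) of the output law of the channel under the input `+1` and of `θ` times
its output law under the input `-1`. Up to normalization it is the least error probability of a
decision about the input when the prior odds for `-1` are `θ`. -/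
def overlap (a : ProbabilityMeasure EReal) (θ : ENNReal) : ENNReal :=
  ((a : Measure EReal) ⊓ θ • (reflect a : Measure EReal)) Set.univ

/-- The channel `a` is at least as good as `b` for deciding about the input, whatever the (finite)
prior odds. -/
def OverlapLE (a b : ProbabilityMeasure EReal) : Prop :=
  ∀ θ : ENNReal, θ ≠ ⊤ → overlap a θ ≤ overlap b θ

theorem OverlapLE.refl (a : ProbabilityMeasure EReal) : OverlapLE a a := fun _ _ => le_rfl

theorem OverlapLE.trans (hab : OverlapLE a b) (hbc : OverlapLE b c) : OverlapLE a c :=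
  fun θ hθ => (hab θ hθ).trans (hbc θ hθ)

theorem bind_mono_measure {α β : Type*} [MeasurableSpace α] [MeasurableSpace β] {μ ν : Measure α}
    (h : μ ≤ ν) (κ : Kernel α β) : μ.bind κ ≤ ν.bind κ :=
  Measure.le_iff.2 fun s hs => by
    rw [Measure.bind_apply hs κ.aemeasurable, Measure.bind_apply hs κ.aemeasurable]
    exact lintegral_mono' h le_rfl

/-- A further channel preserves masses, so it maps the common part of two laws to a common part, of
the same mass, of their images. -/
theorem IsDegraded.overlapLE (h : IsDegraded b a) : OverlapLE a b := by
  obtain ⟨Q, _, hb, hrb⟩ := h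
  intro θ _
  let μ := (a : Measure EReal) ⊓ θ • (reflect a : Measure EReal)
  calc overlap a θ = μ.bind Q Set.univ := by
        simp [overlap, μ, Measure.bind_apply .univ Q.aemeasurable]
    _ ≤ overlap b θ := by
        refine (le_inf ?_ ?_ : μ.bind Q ≤ _) _
        · rw [hb]
          exact bind_mono_measure inf_le_left Q
        · rw [hrb, ← Measure.bind_smul]
          exact bind_mono_measure inf_le_right Q

theorem inf_withDensity {α : Type*} [MeasurableSpace α] (μ : Measure α) {f : α → ENNReal}
    (hf : Measurable f) : μ ⊓ μ.withDensity f = μ.withDensity fun x => min 1 (f x) := by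
  refine le_antisymm (Measure.le_iff.2 fun s hs => ?_) (le_inf ?_ ?_)
  · have hle : MeasurableSet {x | f x ≤ 1} := measurableSet_le hf measurable_const
    calc (μ ⊓ μ.withDensity f) s
        = (μ ⊓ μ.withDensity f) (s ∩ {x | f x ≤ 1}) +
            (μ ⊓ μ.withDensity f) (s \ {x | f x ≤ 1}) := (measure_inter_add_sdiff s hle).symm
      _ ≤ μ.withDensity f (s ∩ {x | f x ≤ 1}) + μ (s \ {x | f x ≤ 1}) :=
          add_le_add (inf_le_right (a := μ) _) (inf_le_left (b := μ.withDensity f) _)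
      _ = ∫⁻ x in s ∩ {x | f x ≤ 1}, min 1 (f x) ∂μ +
            ∫⁻ x in s \ {x | f x ≤ 1}, min 1 (f x) ∂μ := by
          rw [withDensity_apply _ (hs.inter hle), ← setLIntegral_one]
          congr 1
          · exact setLIntegral_congr_fun (hs.inter hle) fun x hx => (min_eq_right hx.2).symm
          · exact setLIntegral_congr_fun (hs.diff hle)
              fun x hx => (min_eq_left (not_le.1 hx.2).le).symm
      _ = μ.withDensity (fun x => min 1 (f x)) s := by
          rw [lintegral_inter_add_sdiff _ _ hle, withDensity_apply _ hs]
  · calc μ.withDensity (fun x => min 1 (f x)) ≤ μ.withDensity 1 :=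
          withDensity_mono (ae_of_all _ fun x => min_le_left _ _)
      _ = μ := withDensity_one
  · exact withDensity_mono (ae_of_all _ fun x => min_le_right _ _)

theorem IsLDensity.overlap_eq_lintegral (ha : IsLDensity a) (θ : ENNReal) :
    overlap a θ = ∫⁻ x, min 1 (θ * EReal.exp (-x)) ∂a := by
  let μ : Measure EReal := a
  have hdensity : (θ • (reflect a : Measure EReal)).restrict {⊥}ᶜ =
      μ.withDensity fun x => θ * EReal.exp (-x) := by
    rw [Measure.restrict_smul, ha.restrict_reflect, ← withDensity_smul _ measurable_exp_neg_ereal]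
    rfl
  have hinf : μ ⊓ θ • (reflect a : Measure EReal) =
      μ ⊓ μ.withDensity fun x => θ * EReal.exp (-x) := by
    rw [← hdensity]
    refine le_antisymm (le_inf inf_le_left ?_) (inf_le_inf_left _ Measure.restrict_le_self)
    calc μ ⊓ θ • (reflect a : Measure EReal)
        = (μ ⊓ θ • (reflect a : Measure EReal)).restrict {⊥}ᶜ :=
          (Measure.restrict_eq_self_of_ae_mem <|
            (Measure.absolutelyContinuous_of_le inf_le_left).ae_le ha.ae_ne_bot).symm
      _ ≤ _ := Measure.restrict_mono_measure inf_le_right _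
  rw [overlap, hinf, inf_withDensity μ (measurable_exp_neg_ereal.const_mul θ),
    withDensity_apply _ .univ, Measure.restrict_univ]

theorem IsLDensity.overlap_varConv (ha : IsLDensity a) (hb : IsLDensity b) (θ : ENNReal) :
    overlap (varConv a b) θ = ∫⁻ x, overlap b (θ * EReal.exp (-x)) ∂a := by
  rw [(ha.varConv hb).overlap_eq_lintegral, lintegral_varConv a b
    (f := fun z => min 1 (θ * EReal.exp (-z)))
    (measurable_const.min (measurable_exp_neg_ereal.const_mul θ))]
  simp only [hb.overlap_eq_lintegral]
  refine ha.lintegral_lintegral_congr hb fun x y hx hy => ?_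
  rw [neg_add_of_ne_bot hx hy, EReal.exp_add, mul_assoc]

protected theorem OverlapLE.varConv {a' b' : ProbabilityMeasure EReal} (ha : IsLDensity a)
    (ha' : IsLDensity a') (hb : IsLDensity b) (hb' : IsLDensity b') (haa' : OverlapLE a a')
    (hbb' : OverlapLE b b') : OverlapLE (varConv a b) (varConv a' b') := by
  have hright : ∀ {a b b' : ProbabilityMeasure EReal}, IsLDensity a → IsLDensity b →
      IsLDensity b' → OverlapLE b b' → OverlapLE (varConv a b) (varConv a b') := by
    intro a b b' ha hb hb' h θ hθ
    rw [ha.overlap_varConv hb, ha.overlap_varConv hb']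
    refine lintegral_mono_ae ?_
    filter_upwards [ha.ae_ne_bot] with x hx
    refine h _ (ENNReal.mul_ne_top hθ ?_)
    rwa [ne_eq, EReal.exp_eq_top_iff, EReal.neg_eq_top_iff]
  refine (hright ha hb hb' hbb').trans ?_
  rw [varConv_comm a, varConv_comm a']
  exact hright hb' ha ha' haa'

theorem DegreeDistribution.overlapLE_mix (p : DegreeDistribution)
    {g g' : ℕ → ProbabilityMeasure EReal} (hg : ∀ n, IsLDensity (g n))
    (hg' : ∀ n, IsLDensity (g' n)) (h : ∀ n, OverlapLE (g n) (g' n)) :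
    OverlapLE (p.mix g) (p.mix g') := fun θ hθ => by
  simp only [(p.isLDensity_mix hg).overlap_eq_lintegral,
    (p.isLDensity_mix hg').overlap_eq_lintegral, p.lintegral_mix,
    ← (hg _).overlap_eq_lintegral, ← (hg' _).overlap_eq_lintegral]
  gcongr with n
  exact h n θ hθ

/-- The expected value of `max τ |tanh (X / 2)|`, where `|tanh (X / 2)|` is the reliability of the
output. In terms of it the order by overlap is compatible with check nodes, because
`|tanh (X / 2)|` is multiplicative there. -/
def reliabilityProfile (a : ProbabilityMeasure EReal) (τ : ℝ) : ℝ :=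
  ∫ x, max τ |tanhHalf x| ∂a

theorem integrable_max_abs_tanhHalf (a : ProbabilityMeasure EReal) (τ : ℝ) :
    Integrable (fun x => max τ |tanhHalf x|) (a : Measure EReal) :=
  .of_bound (measurable_const.max measurable_tanhHalf.abs).aestronglyMeasurable (max |τ| 1)
    (ae_of_all _ fun x => abs_max_le_max_abs_abs.trans <|
      max_le_max le_rfl ((abs_abs _).trans_le (abs_tanhHalf_le_one x)))

theorem reliabilityProfile_of_one_le (a : ProbabilityMeasure EReal) {τ : ℝ} (hτ : 1 ≤ τ) :
    reliabilityProfile a τ = τ := by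
  simp [reliabilityProfile, max_eq_left ((abs_tanhHalf_le_one _).trans hτ)]

theorem abs_add_add_abs_sub (u v : ℝ) : |u + v| + |u - v| = 2 * max |u| |v| := by
  grind

theorem min_add_min_eq_max {θ : ℝ} (hθ : 0 ≤ θ) (t : ℝ) :
    min (1 + t) (θ * (1 - t)) + min (1 - t) (θ * (1 + t)) =
      (θ + 1) * (1 - max (|θ - 1| / (θ + 1)) |t|) := by
  have hpos : 0 < θ + 1 := by linarith
  have hmax : (θ + 1) * max (|θ - 1| / (θ + 1)) |t| = max |θ - 1| |(θ + 1) * t| := by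
    rw [mul_max_of_nonneg _ _ hpos.le, mul_div_cancel₀ _ hpos.ne', abs_mul, abs_of_pos hpos]
  have habs := abs_add_add_abs_sub (θ - 1) ((θ + 1) * t)
  rw [mul_one_sub (θ + 1), hmax, min_def, min_def]
  grind

theorem min_mul_posteriorWeight (θ : ENNReal) (x : EReal) :
    min 1 (θ * EReal.exp (-x)) * posteriorWeight x =
      min (posteriorWeight x) (θ * posteriorWeight (-x)) := by
  rcases eq_or_ne x ⊥ with rfl | hx
  · simp
  · rw [← posteriorWeight_mul_exp_neg hx, min_mul_of_nonneg _ _ zero_le, one_mul, mul_right_comm,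
      mul_assoc θ]

theorem IsLDensity.two_mul_overlap (ha : IsLDensity a) {θ : ℝ} (hθ : 0 ≤ θ) :
    2 * overlap a (ENNReal.ofReal θ) =
      ENNReal.ofReal ((θ + 1) * (1 - reliabilityProfile a (|θ - 1| / (θ + 1)))) := by
  set τ := |θ - 1| / (θ + 1)
  have hτ : τ ≤ 1 := (div_le_one (by linarith)).2 (abs_le.2 ⟨by linarith, by linarith⟩)
  have hpoint : ∀ x, min 1 (ENNReal.ofReal θ * EReal.exp (-x)) * posteriorWeight x +
      min 1 (ENNReal.ofReal θ * EReal.exp (- -x)) * posteriorWeight (-x) =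
        ENNReal.ofReal ((θ + 1) * (1 - max τ |tanhHalf x|)) := fun x => by
    obtain ⟨h₁, h₂⟩ := tanhHalf_mem_Icc x
    have hplus : 0 ≤ 1 + tanhHalf x := by linarith
    have hminus : 0 ≤ 1 - tanhHalf x := by linarith
    rw [min_mul_posteriorWeight, min_mul_posteriorWeight, neg_neg, posteriorWeight_neg,
      posteriorWeight, ← ENNReal.ofReal_mul hθ, ← ENNReal.ofReal_mul hθ, ← ENNReal.ofReal_min,
      ← ENNReal.ofReal_min, ← ENNReal.ofReal_add (le_min hplus (mul_nonneg hθ hminus))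
        (le_min hminus (mul_nonneg hθ hplus)), min_add_min_eq_max hθ]
  have hint := integrable_max_abs_tanhHalf a τ
  have hint' : Integrable (fun x => (θ + 1) * (1 - max τ |tanhHalf x|)) (a : Measure EReal) :=
    ((integrable_const 1).sub hint).const_mul _
  rw [ha.overlap_eq_lintegral, ha.two_mul_lintegral
      (measurable_const.min (measurable_exp_neg_ereal.const_mul _)), lintegral_congr hpoint,
    ← ofReal_integral_eq_lintegral_ofReal hint' (ae_of_all _ fun x => mul_nonneg (by linarith)
      (sub_nonneg.2 (max_le hτ (abs_tanhHalf_le_one x)))),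
    integral_const_mul, integral_sub (integrable_const 1) hint]
  simp [reliabilityProfile]

theorem reliabilityProfile_le_one (a : ProbabilityMeasure EReal) {τ : ℝ} (hτ : τ ≤ 1) :
    reliabilityProfile a τ ≤ 1 :=
  (integral_mono (integrable_max_abs_tanhHalf a τ) (integrable_const 1)
    fun x => max_le hτ (abs_tanhHalf_le_one x)).trans_eq (by simp)

theorem overlap_le_overlap_iff (ha : IsLDensity a) (hb : IsLDensity b) {θ : ℝ} (hθ : 0 ≤ θ) :
    overlap a (ENNReal.ofReal θ) ≤ overlap b (ENNReal.ofReal θ) ↔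
      reliabilityProfile b (|θ - 1| / (θ + 1)) ≤ reliabilityProfile a (|θ - 1| / (θ + 1)) := by
  have hpos : 0 < θ + 1 := by linarith
  have hτ : |θ - 1| / (θ + 1) ≤ 1 := (div_le_one hpos).2 (abs_le.2 ⟨by linarith, by linarith⟩)
  rw [← ENNReal.mul_le_mul_iff_right two_ne_zero ENNReal.ofNat_ne_top, ha.two_mul_overlap hθ,
    hb.two_mul_overlap hθ, ENNReal.ofReal_le_ofReal_iff
      (mul_nonneg hpos.le (sub_nonneg.2 (reliabilityProfile_le_one b hτ))),
    mul_le_mul_iff_right₀ hpos, sub_le_sub_iff_left]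

/-- The prior odds `(1 + τ) / (1 - τ)` give rise to the threshold `τ`. -/
theorem overlapLE_iff_reliabilityProfile_le (ha : IsLDensity a) (hb : IsLDensity b) :
    OverlapLE a b ↔ ∀ τ, 0 ≤ τ → reliabilityProfile b τ ≤ reliabilityProfile a τ := by
  constructor
  · intro h τ hτ
    rcases le_or_gt 1 τ with hτ₁ | hτ₁
    · rw [reliabilityProfile_of_one_le a hτ₁, reliabilityProfile_of_one_le b hτ₁]
    have hpos : 0 < 1 - τ := by linarith
    have hθ : 0 ≤ (1 + τ) / (1 - τ) := by positivity
    have hodds : |(1 + τ) / (1 - τ) - 1| / ((1 + τ) / (1 - τ) + 1) = τ := by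
      rw [div_sub_one hpos.ne', div_add_one hpos.ne', abs_div, abs_of_pos hpos,
        div_div_div_cancel_right₀ hpos.ne', abs_of_nonneg (by linarith)]
      ring
    simpa only [hodds] using (overlap_le_overlap_iff ha hb hθ).1 (h _ ENNReal.ofReal_ne_top)
  · intro h θ hθ
    rw [← ENNReal.ofReal_toReal hθ, overlap_le_overlap_iff ha hb ENNReal.toReal_nonneg]
    exact h _ (by positivity)

theorem overlapLE_unitMass_zero (ha : IsLDensity a) : OverlapLE a (unitMass 0) := by
  rw [overlapLE_iff_reliabilityProfile_le ha isLDensity_unitMass_zero]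
  intro τ hτ
  calc reliabilityProfile (unitMass 0) τ = max τ |tanhHalf 0| := integral_dirac _ _
    _ = ∫ _ : EReal, τ ∂a := by simp [hτ]
    _ ≤ reliabilityProfile a τ :=
        integral_mono (integrable_const τ) (integrable_max_abs_tanhHalf a τ)
          fun x => le_max_left _ _

theorem integrable_comp_checkNode (a b : ProbabilityMeasure EReal) {f : EReal → ℝ}
    (hf : Integrable f (checkConv a b : Measure EReal)) :
    Integrable (fun p : EReal × EReal => f (checkNode p.1 p.2))
      ((a : Measure EReal).prod b) := by
  rw [checkConv, ProbabilityMeasure.toMeasure_map] at hf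
  exact hf.comp_measurable measurable_checkNode

theorem integral_checkConv (a b : ProbabilityMeasure EReal) {f : EReal → ℝ}
    (hf : Integrable f (checkConv a b : Measure EReal)) :
    ∫ z, f z ∂(checkConv a b) = ∫ x, ∫ y, f (checkNode x y) ∂b ∂a := by
  rw [← integral_prod _ (integrable_comp_checkNode a b hf)]
  exact integral_map measurable_checkNode.aemeasurable hf.aestronglyMeasurable

theorem reliabilityProfile_checkConv (a b : ProbabilityMeasure EReal) (τ : ℝ) :
    reliabilityProfile (checkConv a b) τ = ∫ x, ∫ y, max τ (|tanhHalf x| * |tanhHalf y|) ∂b ∂a := by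
  simp only [reliabilityProfile, integral_checkConv a b (integrable_max_abs_tanhHalf _ τ),
    tanhHalf_checkNode, abs_mul]

theorem integral_max_mul_abs_tanhHalf_le {τ r : ℝ} (hτ : 0 ≤ τ) (hr : 0 ≤ r)
    (h : ∀ σ, 0 ≤ σ → reliabilityProfile b σ ≤ reliabilityProfile a σ) :
    ∫ y, max τ (r * |tanhHalf y|) ∂b ≤ ∫ y, max τ (r * |tanhHalf y|) ∂a := by
  rcases hr.eq_or_lt with rfl | hr
  · simp
  have hscale : ∀ y, max τ (r * |tanhHalf y|) = r * max (τ / r) |tanhHalf y| := fun y => by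
    rw [mul_max_of_nonneg _ _ hr.le, mul_div_cancel₀ _ hr.ne']
  simp only [hscale, integral_const_mul]
  exact mul_le_mul_of_nonneg_left (h _ (by positivity)) hr.le

protected theorem OverlapLE.checkConv {a' b' : ProbabilityMeasure EReal} (ha : IsLDensity a)
    (ha' : IsLDensity a') (hb : IsLDensity b) (hb' : IsLDensity b') (haa' : OverlapLE a a')
    (hbb' : OverlapLE b b') : OverlapLE (checkConv a b) (checkConv a' b') := by
  have hright : ∀ {a b b' : ProbabilityMeasure EReal}, IsLDensity a → IsLDensity b →
      IsLDensity b' → OverlapLE b b' → OverlapLE (checkConv a b) (checkConv a b') := by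
    intro a b b' ha hb hb' h
    rw [overlapLE_iff_reliabilityProfile_le hb hb'] at h
    rw [overlapLE_iff_reliabilityProfile_le (ha.checkConv hb) (ha.checkConv hb')]
    intro τ hτ
    have hint : ∀ b : ProbabilityMeasure EReal, Integrable
        (fun x => ∫ y, max τ (|tanhHalf x| * |tanhHalf y|) ∂b) (a : Measure EReal) := fun b => by
      simpa only [tanhHalf_checkNode, abs_mul] using
        (integrable_comp_checkNode a b (integrable_max_abs_tanhHalf _ τ)).integral_prod_left
    rw [reliabilityProfile_checkConv, reliabilityProfile_checkConv]
    exact integral_mono (hint b') (hint b)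
      fun x => integral_max_mul_abs_tanhHalf_le hτ (abs_nonneg _) h
  refine (hright ha hb hb' hbb').trans ?_
  rw [checkConv_comm a, checkConv_comm a']
  exact hright hb' ha ha' haa'

protected theorem OverlapLE.varPow (ha : IsLDensity a) (hb : IsLDensity b) (h : OverlapLE a b) :
    ∀ n, OverlapLE (varPow a n) (varPow b n)
  | 0 => .refl _
  | n + 1 => .varConv ha hb (ha.varPow n) (hb.varPow n) h (.varPow ha hb h n)

protected theorem OverlapLE.checkPow (ha : IsLDensity a) (hb : IsLDensity b) (h : OverlapLE a b) :
    ∀ n, OverlapLE (checkPow a n) (checkPow b n)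
  | 0 => .refl _
  | n + 1 => .checkConv ha hb (ha.checkPow n) (hb.checkPow n) h (.checkPow ha hb h n)

protected theorem OverlapLE.densityEvolution (lam rho : DegreeDistribution)
    {c' a' : ProbabilityMeasure EReal} (hc : IsLDensity c) (hc' : IsLDensity c')
    (ha : IsLDensity a) (ha' : IsLDensity a') (hcc' : OverlapLE c c') (haa' : OverlapLE a a') :
    OverlapLE (densityEvolution lam rho c a) (densityEvolution lam rho c' a') := by
  have hρ := rho.isLDensity_mix ha.checkPow
  have hρ' := rho.isLDensity_mix ha'.checkPow
  refine .varConv hc hc' (lam.isLDensity_mix hρ.varPow) (lam.isLDensity_mix hρ'.varPow) hcc' ?_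
  refine lam.overlapLE_mix hρ.varPow hρ'.varPow (.varPow hρ hρ' ?_)
  exact rho.overlapLE_mix ha.checkPow ha'.checkPow (.checkPow ha ha' haa')

/-! ### Even moments -/

/-- The `2k`-th moment of the soft bit `tanh (X / 2)`. -/
def evenMoment (a : ProbabilityMeasure EReal) (k : ℕ) : ℝ :=
  ∫ x, tanhHalf x ^ (2 * k) ∂a

theorem integrable_tanhHalf_pow (a : ProbabilityMeasure EReal) (n : ℕ) :
    Integrable (fun x => tanhHalf x ^ n) (a : Measure EReal) :=
  .of_bound (measurable_tanhHalf.pow_const n).aestronglyMeasurable 1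
    (ae_of_all _ fun x => abs_tanhHalf_pow_le_one x n)

theorem evenMoment_nonneg (a : ProbabilityMeasure EReal) (k : ℕ) : 0 ≤ evenMoment a k :=
  integral_nonneg fun _ => (even_two_mul k).pow_nonneg _

theorem antitone_evenMoment (a : ProbabilityMeasure EReal) : Antitone (evenMoment a) :=
  antitone_nat_of_succ_le fun k =>
    integral_mono (integrable_tanhHalf_pow a _) (integrable_tanhHalf_pow a _) fun x => by
      simp only [pow_mul]
      exact pow_le_pow_of_le_one (sq_nonneg _) (tanhHalf_sq_le_one x) k.le_succ

@[simp] theorem evenMoment_zero (a : ProbabilityMeasure EReal) : evenMoment a 0 = 1 := by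
  simp [evenMoment]

theorem evenMoment_checkConv (a b : ProbabilityMeasure EReal) (k : ℕ) :
    evenMoment (checkConv a b) k = evenMoment a k * evenMoment b k := by
  simp only [evenMoment, integral_checkConv a b (integrable_tanhHalf_pow _ _), tanhHalf_checkNode,
    mul_pow, integral_const_mul, integral_mul_const]

theorem evenMoment_checkPow (a : ProbabilityMeasure EReal) (n k : ℕ) :
    evenMoment (checkPow a n) k = evenMoment a k ^ n := by
  induction n with
  | zero => simp [evenMoment, checkPow, unitMass]
  | succ n ih => rw [checkPow, evenMoment_checkConv, ih, pow_succ']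

/-- The `L`-density symmetry says that `(1 - tanh (x / 2)) a(dx)` is an even measure. -/
theorem IsLDensity.integral_neg_mul (ha : IsLDensity a) (f : EReal → ℝ) :
    ∫ x, (1 - tanhHalf x) * f (-x) ∂a = ∫ x, (1 - tanhHalf x) * f x ∂a := by
  have hw : Measurable fun x => posteriorWeight (-x) :=
    measurable_posteriorWeight.comp measurable_neg
  let ν := (a : Measure EReal).withDensity fun x => posteriorWeight (-x)
  have hν : ∀ g : EReal → ENNReal, Measurable g →
      ∫⁻ x, g x ∂ν = ∫⁻ x, g x * posteriorWeight (-x) ∂a := fun g hg => by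
    rw [lintegral_withDensity_eq_lintegral_mul _ hw hg]
    simp only [Pi.mul_apply, mul_comm]
  have heven : ν.map (MeasurableEquiv.neg EReal) = ν := Measure.ext_of_lintegral _ fun g hg => by
    rw [lintegral_map hg (MeasurableEquiv.measurable _), hν g hg,
      ← ha.lintegral_neg_mul_posteriorWeight hg]
    exact hν _ (hg.comp measurable_neg)
  have hreal : ∀ g : EReal → ℝ, ∫ x, g x ∂ν = ∫ x, (1 - tanhHalf x) * g x ∂a := fun g => by
    rw [integral_withDensity_eq_integral_toReal_smul hw
      (ae_of_all _ fun x => (posteriorWeight_ne_top _).lt_top)]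
    refine integral_congr_ae (ae_of_all _ fun x => ?_)
    simp only [posteriorWeight_neg, smul_eq_mul,
      ENNReal.toReal_ofReal (sub_nonneg.2 (tanhHalf_mem_Icc x).2)]
  calc ∫ x, (1 - tanhHalf x) * f (-x) ∂a
      = ∫ x, f (-x) ∂ν := (hreal fun x => f (-x)).symm
    _ = ∫ x, f x ∂(ν.map (MeasurableEquiv.neg EReal)) :=
        (MeasureTheory.integral_map_equiv (MeasurableEquiv.neg EReal) f).symm
    _ = ∫ x, (1 - tanhHalf x) * f x ∂a := by rw [heven, hreal]

theorem IsLDensity.integral_tanhHalf_pow_odd (ha : IsLDensity a) (k : ℕ) :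
    ∫ x, tanhHalf x ^ (2 * k + 1) ∂a = evenMoment a (k + 1) := by
  have hsymm := ha.integral_neg_mul fun x => tanhHalf x ^ (2 * k + 1)
  simp only [tanhHalf_neg, (odd_two_mul_add_one k).neg_pow, mul_neg, integral_neg, sub_mul, one_mul,
    ← pow_succ'] at hsymm
  rw [integral_sub (integrable_tanhHalf_pow a _) (integrable_tanhHalf_pow a _)] at hsymm
  rw [evenMoment, mul_add_one]
  linarith

theorem integral_pow_mul_max (n : ℕ) {r : ℝ} (hr₀ : 0 ≤ r) (hr₁ : r ≤ 1) :
    ∫ τ in (0 : ℝ)..1, (n + 2) * (n + 1) * τ ^ n * max τ r = r ^ (n + 2) + (n + 1) := by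
  have hcont : Continuous fun τ : ℝ => (n + 2) * (n + 1) * τ ^ n * max τ r := by fun_prop
  have hleft : ∫ τ in (0 : ℝ)..r, (n + 2) * (n + 1) * τ ^ n * max τ r =
      ∫ τ in (0 : ℝ)..r, (n + 2) * (n + 1) * r * τ ^ n :=
    intervalIntegral.integral_congr fun τ hτ => by
      rw [Set.uIcc_of_le hr₀] at hτ
      simp only [max_eq_right hτ.2]
      ring
  have hright : ∫ τ in r..1, (n + 2) * (n + 1) * τ ^ n * max τ r =
      ∫ τ in r..1, (n + 2) * (n + 1) * τ ^ (n + 1) :=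
    intervalIntegral.integral_congr fun τ hτ => by
      rw [Set.uIcc_of_le hr₁] at hτ
      simp only [max_eq_left hτ.1]
      ring
  rw [← intervalIntegral.integral_add_adjacent_intervals (hcont.intervalIntegrable 0 r)
    (hcont.intervalIntegrable r 1), hleft, hright]
  simp only [intervalIntegral.integral_const_mul, integral_pow]
  push_cast
  field_simp
  ring

theorem monotone_reliabilityProfile (a : ProbabilityMeasure EReal) :
    Monotone (reliabilityProfile a) := fun _ _ h =>
  integral_mono (integrable_max_abs_tanhHalf a _) (integrable_max_abs_tanhHalf a _)
    fun _ => max_le_max h le_rfl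

theorem integral_pow_mul_reliabilityProfile (a : ProbabilityMeasure EReal) (n : ℕ) :
    ∫ τ in (0 : ℝ)..1, (n + 2) * (n + 1) * τ ^ n * reliabilityProfile a τ =
      ∫ x, |tanhHalf x| ^ (n + 2) ∂a + (n + 1) := by
  have hint : Integrable (fun p : ℝ × EReal => (n + 2) * (n + 1) * p.1 ^ n * max p.1 |tanhHalf p.2|)
      ((volume.restrict (Set.uIoc 0 1)).prod a) := by
    rw [Set.uIoc_of_le zero_le_one]
    have hmeas : Measurable fun p : ℝ × EReal =>
        (n + 2) * (n + 1) * p.1 ^ n * max p.1 |tanhHalf p.2| :=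
      ((measurable_fst.pow_const n).const_mul _).mul
        (measurable_fst.max (measurable_tanhHalf.comp measurable_snd).abs)
    have hmem : ∀ᵐ p ∂((volume.restrict (Set.Ioc (0 : ℝ) 1)).prod (a : Measure EReal)),
        p.1 ∈ Set.Ioc (0 : ℝ) 1 :=
      Measure.quasiMeasurePreserving_fst.ae (ae_restrict_mem measurableSet_Ioc)
    refine .of_bound hmeas.aestronglyMeasurable ((n + 2) * (n + 1) * 1 ^ n * 1) ?_
    filter_upwards [hmem] with p hp
    have := hp.1
    rw [Real.norm_of_nonneg (by positivity)]
    gcongr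
    exacts [hp.2, max_le hp.2 (abs_tanhHalf_le_one _)]
  calc ∫ τ in (0 : ℝ)..1, (n + 2) * (n + 1) * τ ^ n * reliabilityProfile a τ
      = ∫ τ in (0 : ℝ)..1, ∫ x, (n + 2) * (n + 1) * τ ^ n * max τ |tanhHalf x| ∂a := by
        simp only [reliabilityProfile, integral_const_mul]
    _ = ∫ x, (|tanhHalf x| ^ (n + 2) + (n + 1)) ∂a := by
        rw [intervalIntegral_integral_swap hint]
        simp only [integral_pow_mul_max n (abs_nonneg _) (abs_tanhHalf_le_one _)]
    _ = ∫ x, |tanhHalf x| ^ (n + 2) ∂a + (n + 1) := by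
        rw [integral_add _ (integrable_const _)]
        · simp
        simpa only [abs_pow] using (integrable_tanhHalf_pow a (n + 2)).abs

theorem OverlapLE.evenMoment_le (ha : IsLDensity a) (hb : IsLDensity b) (h : OverlapLE a b) :
    evenMoment b ≤ evenMoment a := by
  rw [overlapLE_iff_reliabilityProfile_le ha hb] at h
  have habs : ∀ (a : ProbabilityMeasure EReal) (k : ℕ), evenMoment a (k + 1) =
      (∫ τ in (0 : ℝ)..1, ((2 * k : ℕ) + 2) * ((2 * k : ℕ) + 1) * τ ^ (2 * k) *
        reliabilityProfile a τ) - ((2 * k : ℕ) + 1) := fun a k => by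
    rw [integral_pow_mul_reliabilityProfile, add_sub_cancel_right]
    simp only [evenMoment, ← mul_add_one, (even_two_mul _).pow_abs]
  have hint : ∀ (a : ProbabilityMeasure EReal) (k : ℕ), IntervalIntegrable
      (fun τ => ((2 * k : ℕ) + 2) * ((2 * k : ℕ) + 1) * τ ^ (2 * k) * reliabilityProfile a τ)
      volume 0 1 := fun a k =>
    (monotone_reliabilityProfile a).intervalIntegrable.continuousOn_mul (by fun_prop)
  rintro (_ | k)
  · simp
  rw [habs, habs]
  refine sub_le_sub_right (intervalIntegral.integral_mono_on zero_le_one (hint b k) (hint a k)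
    fun τ hτ => ?_) _
  have := hτ.1
  gcongr
  exact h τ this

/-! ### The Bhattacharyya parameter -/

theorem measurable_exp_neg_half : Measurable fun x : EReal => EReal.exp (-x / 2) := by
  simp only [div_eq_mul_inv]
  exact (measurable_neg.mul_const _).ereal_exp

theorem exp_neg_half_add {x y : EReal} (hx : x ≠ ⊥) (hy : y ≠ ⊥) :
    EReal.exp (-(x + y) / 2) = EReal.exp (-x / 2) * EReal.exp (-y / 2) := by
  have htwo : (2 : EReal) = ((2 : ℝ) : EReal) := rfl
  rw [← EReal.exp_add, neg_add_of_ne_bot hx hy, htwo]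
  simp only [div_eq_mul_inv, ← EReal.coe_inv]
  rw [EReal.right_distrib_of_nonneg_of_ne_top (by norm_num) (EReal.coe_ne_top _)]

theorem integrable_sqrt_one_sub_tanhHalf_sq (a : ProbabilityMeasure EReal) :
    Integrable (fun x => √(1 - tanhHalf x ^ 2)) (a : Measure EReal) :=
  .of_bound (measurable_const.sub (measurable_tanhHalf.pow_const 2)).sqrt.aestronglyMeasurable 1
    (ae_of_all _ fun x => by
      rw [Real.norm_of_nonneg (Real.sqrt_nonneg _), Real.sqrt_le_one]
      linarith [sq_nonneg (tanhHalf x)])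

theorem IsLDensity.lintegral_exp_neg_half (ha : IsLDensity a) :
    ∫⁻ x, EReal.exp (-x / 2) ∂a = ENNReal.ofReal (∫ x, √(1 - tanhHalf x ^ 2) ∂a) := by
  rw [ofReal_integral_eq_lintegral_ofReal (integrable_sqrt_one_sub_tanhHalf_sq a)
      (ae_of_all _ fun _ => Real.sqrt_nonneg _),
    ← ENNReal.mul_right_inj two_ne_zero ENNReal.ofNat_ne_top,
    ha.two_mul_lintegral measurable_exp_neg_half, ← lintegral_const_mul' _ _ ENNReal.ofNat_ne_top]
  refine lintegral_congr fun x => ?_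
  rw [mul_comm, posteriorWeight_mul_exp_neg_half, mul_comm _ (posteriorWeight (-x)),
    posteriorWeight_mul_exp_neg_half, tanhHalf_neg, neg_sq, two_mul]

theorem IsLDensity.bhattacharyya_eq_integral (ha : IsLDensity a) :
    bhattacharyya a = ∫ x, √(1 - tanhHalf x ^ 2) ∂a := by
  rw [bhattacharyya, ha.lintegral_exp_neg_half,
    ENNReal.toReal_ofReal (integral_nonneg fun _ => Real.sqrt_nonneg _)]

theorem bhattacharyya_nonneg (a : ProbabilityMeasure EReal) : 0 ≤ bhattacharyya a :=
  ENNReal.toReal_nonneg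

theorem IsLDensity.evenMoment_one_le (ha : IsLDensity a) :
    evenMoment a 1 ≤ 1 - bhattacharyya a ^ 2 := by
  have hint := (integrable_sqrt_one_sub_tanhHalf_sq a).const_mul (2 * bhattacharyya a)
  have htangent : ∫ x, (2 * bhattacharyya a * √(1 - tanhHalf x ^ 2) - bhattacharyya a ^ 2) ∂a ≤
      ∫ x, (1 - tanhHalf x ^ 2) ∂a := by
    refine integral_mono (hint.sub (integrable_const _))
      ((integrable_const _).sub (integrable_tanhHalf_pow a 2)) fun x => ?_
    linarith [two_mul_le_add_sq (bhattacharyya a) √(1 - tanhHalf x ^ 2),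
      Real.sq_sqrt (sub_nonneg.2 (tanhHalf_sq_le_one x))]
  rw [integral_sub hint (integrable_const _), integral_const_mul, ← ha.bhattacharyya_eq_integral,
    integral_sub (integrable_const _) (integrable_tanhHalf_pow a 2)] at htangent
  simp only [integral_const, probReal_univ, one_smul] at htangent
  rw [evenMoment, mul_one]
  linarith

theorem IsLDensity.bhattacharyya_sq_le_one (ha : IsLDensity a) : bhattacharyya a ^ 2 ≤ 1 := by
  linarith [evenMoment_nonneg a 1, ha.evenMoment_one_le]

theorem IsLDensity.bhattacharyya_le_one (ha : IsLDensity a) : bhattacharyya a ≤ 1 :=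
  (sq_le_one_iff₀ (bhattacharyya_nonneg a)).1 ha.bhattacharyya_sq_le_one

theorem IsLDensity.bhattacharyya_varConv (ha : IsLDensity a) (hb : IsLDensity b) :
    bhattacharyya (varConv a b) = bhattacharyya a * bhattacharyya b := by
  rw [bhattacharyya, lintegral_varConv a b measurable_exp_neg_half,
    ha.lintegral_lintegral_congr hb fun x y hx hy => exp_neg_half_add hx hy]
  simp only [lintegral_const_mul _ measurable_exp_neg_half,
    lintegral_mul_const _ measurable_exp_neg_half, ENNReal.toReal_mul, bhattacharyya]

theorem DegreeDistribution.bhattacharyya_mix (p : DegreeDistribution)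
    {g : ℕ → ProbabilityMeasure EReal} (hg : ∀ n, IsLDensity (g n)) :
    bhattacharyya (p.mix g) = ∑ n ∈ Finset.range (p.poly.natDegree + 1),
      p.poly.coeff n * bhattacharyya (g n) := by
  have hne : ∀ n, ∫⁻ x, EReal.exp (-x / 2) ∂(g n) ≠ ⊤ := fun n =>
    (hg n).lintegral_exp_neg_half.trans_ne ENNReal.ofReal_ne_top
  rw [bhattacharyya, p.lintegral_mix,
    ENNReal.toReal_sum fun n _ => ENNReal.mul_ne_top ENNReal.ofReal_ne_top (hne n)]
  simp only [ENNReal.toReal_mul, ENNReal.toReal_ofReal (p.coeff_nonneg _), bhattacharyya]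

theorem IsLDensity.bhattacharyya_varPow (ha : IsLDensity a) (n : ℕ) :
    bhattacharyya (varPow a n) = bhattacharyya a ^ n := by
  induction n with
  | zero => simp [bhattacharyya, varPow, lintegral_unitMass]
  | succ n ih => rw [varPow, ha.bhattacharyya_varConv (ha.varPow n), ih, pow_succ']

theorem IsLDensity.bhattacharyya_densityEvolution (lam rho : DegreeDistribution)
    (hc : IsLDensity c) (ha : IsLDensity a) : bhattacharyya (densityEvolution lam rho c a) =
      bhattacharyya c * lam.poly.eval (bhattacharyya (rho.mix (checkPow a))) := by
  have h := rho.isLDensity_mix ha.checkPow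
  rw [densityEvolution, hc.bhattacharyya_varConv (lam.isLDensity_mix h.varPow),
    lam.bhattacharyya_mix h.varPow, Polynomial.eval_eq_sum_range]
  simp only [h.bhattacharyya_varPow]

/-! ### The power series of `1 - √(1 - x)` -/

/-- The coefficient of `x ^ (k + 1)` in the power series of `1 - √(1 - x)`. -/
def sqrtCoeff (k : ℕ) : ℝ := (-1) ^ k * Ring.choose (1 / 2 : ℝ) (k + 1)

theorem sqrtCoeff_zero : sqrtCoeff 0 = 1 / 2 := by
  simp [sqrtCoeff]

theorem sqrtCoeff_succ (k : ℕ) : sqrtCoeff (k + 1) = sqrtCoeff k * ((k + 1 / 2) / (k + 2)) := by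
  have hchoose := Ring.choose_smul_choose (1 / 2 : ℝ) (Nat.le_succ (k + 1))
  simp only [Nat.succ_eq_add_one, Nat.choose_succ_self_right, nsmul_eq_mul, Nat.add_sub_cancel_left,
    Ring.choose_one_right, Nat.cast_add, Nat.cast_one] at hchoose
  rw [sqrtCoeff, sqrtCoeff, pow_succ]
  field_simp
  linear_combination (-1 : ℝ) * 2 * hchoose

theorem sqrtCoeff_pos (k : ℕ) : 0 < sqrtCoeff k := by
  induction k with
  | zero => norm_num [sqrtCoeff_zero]
  | succ k ih =>
    rw [sqrtCoeff_succ]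
    positivity

theorem hasSum_one_sub_sqrt_of_lt_one {x : ℝ} (hx₀ : 0 ≤ x) (hx₁ : x < 1) :
    HasSum (fun k => sqrtCoeff k * x ^ (k + 1)) (1 - √(1 - x)) := by
  have hbinomial := (Real.one_add_rpow_hasFPowerSeriesOnBall_zero (a := 1 / 2)).hasSum (y := -x)
    (by simpa [Real.enorm_eq_ofReal_abs, abs_of_nonneg hx₀] using hx₁)
  have htail := ((hasSum_nat_add_iff' 1).2 hbinomial).neg
  have hcoeff : ∀ k, sqrtCoeff k * x ^ (k + 1) =
      -(Ring.choose (1 / 2 : ℝ) (k + 1) * (-x) ^ (k + 1)) := fun k => by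
    rw [sqrtCoeff, neg_pow x]
    ring
  simpa only [hcoeff, binomialSeries_apply, List.ofFn_const, List.prod_replicate,
    Finset.sum_range_one, Ring.choose_zero_right, pow_zero, smul_eq_mul, mul_one,
    ← sub_eq_add_neg, zero_sub, ← Real.sqrt_eq_rpow, neg_sub] using htail

/-- A power series with nonnegative coefficients extends from `[0, 1)` to the endpoint `1` without
any tail estimate: its partial sums are bounded by the left limit. -/
theorem hasSum_of_tendsto_of_hasSum_mul_pow {u : ℕ → ℝ} {e : ℕ → ℕ} {F : ℝ → ℝ} {s : ℝ}
    (hu : ∀ k, 0 ≤ u k) (hF : Tendsto F (𝓝[<] 1) (𝓝 s))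
    (h : ∀ x, 0 ≤ x → x < 1 → HasSum (fun k => u k * x ^ e k) (F x)) : HasSum u s := by
  have hnear : ∀ᶠ x : ℝ in 𝓝[<] 1, 0 ≤ x ∧ x < 1 := by
    filter_upwards [Ioo_mem_nhdsLT (zero_lt_one' ℝ)] with x hx
    exact ⟨hx.1.le, hx.2⟩
  have hpartial : ∀ N, ∑ k ∈ Finset.range N, u k ≤ s := fun N => by
    have hcont : Continuous fun x : ℝ => ∑ k ∈ Finset.range N, u k * x ^ e k := by fun_prop
    have hlim := (hcont.tendsto 1).mono_left (nhdsWithin_le_nhds (s := Set.Iio 1))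
    simp only [one_pow, mul_one] at hlim
    refine le_of_tendsto_of_tendsto hlim hF ?_
    filter_upwards [hnear] with x hx
    exact sum_le_hasSum _ (fun k _ => mul_nonneg (hu k) (pow_nonneg hx.1 _)) (h x hx.1 hx.2)
  have hsum : Summable u := summable_of_sum_range_le hu hpartial
  have hge : s ≤ ∑' k, u k := le_of_tendsto hF <| by
    filter_upwards [hnear] with x hx
    exact hasSum_le (fun k => mul_le_of_le_one_right (hu k) (pow_le_one₀ hx.1 hx.2.le))
      (h x hx.1 hx.2) hsum.hasSum
  exact le_antisymm (Real.tsum_le_of_sum_range_le hu hpartial) hge ▸ hsum.hasSum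

theorem hasSum_one_sub_sqrt {x : ℝ} (hx₀ : 0 ≤ x) (hx₁ : x ≤ 1) :
    HasSum (fun k => sqrtCoeff k * x ^ (k + 1)) (1 - √(1 - x)) := by
  rcases hx₁.lt_or_eq with hx₁ | rfl
  · exact hasSum_one_sub_sqrt_of_lt_one hx₀ hx₁
  have hcont : Continuous fun x : ℝ => 1 - √(1 - x) := by fun_prop
  simpa only [one_pow, mul_one] using hasSum_of_tendsto_of_hasSum_mul_pow
    (fun k => (sqrtCoeff_pos k).le) ((hcont.tendsto 1).mono_left nhdsWithin_le_nhds)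
    fun x hx₀ hx₁ => hasSum_one_sub_sqrt_of_lt_one hx₀ hx₁

theorem IsLDensity.hasSum_evenMoment (ha : IsLDensity a) :
    HasSum (fun k => sqrtCoeff k * evenMoment a (k + 1)) (1 - bhattacharyya a) := by
  have hsummable : Summable sqrtCoeff := by
    simpa using (hasSum_one_sub_sqrt zero_le_one le_rfl).summable
  have h := hasSum_integral_of_dominated_convergence (μ := (a : Measure EReal))
    (F := fun k x => sqrtCoeff k * tanhHalf x ^ (2 * (k + 1)))
    (f := fun x => 1 - √(1 - tanhHalf x ^ 2)) (fun k _ => sqrtCoeff k)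
    (fun k => ((measurable_tanhHalf.pow_const _).const_mul _).aestronglyMeasurable)
    (fun k => ae_of_all _ fun x => by
      rw [norm_mul, Real.norm_of_nonneg (sqrtCoeff_pos k).le]
      exact mul_le_of_le_one_right (sqrtCoeff_pos k).le (abs_tanhHalf_pow_le_one x _))
    (ae_of_all _ fun _ => hsummable) (integrable_const _)
    (ae_of_all _ fun x => by
      simpa only [← pow_mul] using hasSum_one_sub_sqrt (sq_nonneg _) (tanhHalf_sq_le_one x))
  rw [integral_sub (integrable_const _) (integrable_sqrt_one_sub_tanhHalf_sq a),
    ← ha.bhattacharyya_eq_integral] at h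
  simpa only [integral_const_mul, integral_const, probReal_univ, one_smul, evenMoment] using h

/-! ### Contraction of density evolution -/

theorem pow_sub_pow_le {x y : ℝ} (hy : 0 ≤ y) (hxy : y ≤ x) (n : ℕ) :
    x ^ n - y ^ n ≤ n * x ^ (n - 1) * (x - y) := by
  have hx := hy.trans hxy
  calc x ^ n - y ^ n ≤ |x ^ n - y ^ n| := le_abs_self _
    _ ≤ |x - y| * n * max |x| |y| ^ (n - 1) := abs_pow_sub_pow_le x y n
    _ = n * x ^ (n - 1) * (x - y) := by
      rw [abs_of_nonneg (sub_nonneg.2 hxy), abs_of_nonneg hx, abs_of_nonneg hy, max_eq_left hxy]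
      ring

theorem DegreeDistribution.eval_derivative (p : DegreeDistribution) (x : ℝ) :
    p.poly.derivative.eval x = ∑ n ∈ Finset.range (p.poly.natDegree + 1),
      p.poly.coeff n * (n * x ^ (n - 1)) := by
  rw [Polynomial.derivative_eval, Polynomial.sum_over_range _ (by simp)]
  exact Finset.sum_congr rfl fun n _ => mul_assoc _ _ _

theorem DegreeDistribution.eval_derivative_nonneg (p : DegreeDistribution) {x : ℝ} (hx : 0 ≤ x) :
    0 ≤ p.poly.derivative.eval x := by
  rw [p.eval_derivative]
  exact Finset.sum_nonneg fun n _ => mul_nonneg (p.coeff_nonneg n) (by positivity)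

theorem DegreeDistribution.eval_le_one (p : DegreeDistribution) {x : ℝ} (hx₀ : 0 ≤ x)
    (hx₁ : x ≤ 1) : p.poly.eval x ≤ 1 := by
  rw [← p.eval_one, Polynomial.eval_eq_sum_range, Polynomial.eval_eq_sum_range]
  gcongr with n
  exact p.coeff_nonneg n

theorem DegreeDistribution.eval_sub_le (p : DegreeDistribution) {x y : ℝ} (hy : 0 ≤ y)
    (hxy : y ≤ x) (hx : x ≤ 1) :
    p.poly.eval x - p.poly.eval y ≤ p.poly.derivative.eval 1 * (x - y) := by
  rw [p.eval_derivative, Polynomial.eval_eq_sum_range, Polynomial.eval_eq_sum_range,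
    ← Finset.sum_sub_distrib, Finset.sum_mul]
  refine Finset.sum_le_sum fun n _ => ?_
  rw [← mul_sub, mul_assoc]
  refine mul_le_mul_of_nonneg_left ((pow_sub_pow_le hy hxy n).trans ?_) (p.coeff_nonneg n)
  have := hy.trans hxy
  have := sub_nonneg.2 hxy
  gcongr

theorem uniquenessFactor_nonneg (lam rho : DegreeDistribution) (c : ProbabilityMeasure EReal)
    (ha : IsLDensity a) : 0 ≤ uniquenessFactor lam rho c a :=
  mul_nonneg (mul_nonneg (bhattacharyya_nonneg c) (lam.eval_derivative_nonneg zero_le_one))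
    (rho.eval_derivative_nonneg (sub_nonneg.2 ha.bhattacharyya_sq_le_one))

theorem bhattacharyya_le_of_evenMoment_le (ha : IsLDensity a) (hb : IsLDensity b)
    (h : evenMoment b ≤ evenMoment a) : bhattacharyya a ≤ bhattacharyya b :=
  sub_le_sub_iff_left 1 |>.1 <| hasSum_le
    (fun k => mul_le_mul_of_nonneg_left (h (k + 1)) (sqrtCoeff_pos k).le)
    hb.hasSum_evenMoment ha.hasSum_evenMoment

theorem evenMoment_checkPow_le (h : evenMoment b ≤ evenMoment a) (n : ℕ) :
    evenMoment (checkPow b n) ≤ evenMoment (checkPow a n) := fun k => by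
  rw [evenMoment_checkPow, evenMoment_checkPow]
  exact pow_le_pow_left₀ (evenMoment_nonneg b k) (h k) n

/-- Check-node powers raise every even moment to the `n`-th power, so the mean value inequality for
`x ^ n` applies to the moment series term by term; all moments are at most `1 - B(a) ^ 2`. -/
theorem bhattacharyya_checkPow_sub_le (ha : IsLDensity a) (hb : IsLDensity b)
    (h : evenMoment b ≤ evenMoment a) (n : ℕ) :
    bhattacharyya (checkPow b n) - bhattacharyya (checkPow a n) ≤
      n * (1 - bhattacharyya a ^ 2) ^ (n - 1) * (bhattacharyya b - bhattacharyya a) := by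
  have hpow := (ha.checkPow n).hasSum_evenMoment.sub (hb.checkPow n).hasSum_evenMoment
  have hbase := (ha.hasSum_evenMoment.sub hb.hasSum_evenMoment).mul_left
    (n * (1 - bhattacharyya a ^ 2) ^ (n - 1))
  rw [sub_sub_sub_cancel_left] at hpow hbase
  refine hasSum_le (fun k => ?_) hpow hbase
  have hle := h (k + 1)
  have hmoment : evenMoment a (k + 1) ≤ 1 - bhattacharyya a ^ 2 :=
    (antitone_evenMoment a (Nat.le_add_left 1 k)).trans ha.evenMoment_one_le
  rw [evenMoment_checkPow, evenMoment_checkPow, ← mul_sub, ← mul_sub, mul_left_comm]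
  refine mul_le_mul_of_nonneg_left
    ((pow_sub_pow_le (evenMoment_nonneg b _) hle n).trans ?_) (sqrtCoeff_pos k).le
  have := evenMoment_nonneg a (k + 1)
  have := sub_nonneg.2 hle
  gcongr

theorem DegreeDistribution.bhattacharyya_mix_checkPow_le (p : DegreeDistribution)
    (ha : IsLDensity a) (hb : IsLDensity b) (h : evenMoment b ≤ evenMoment a) :
    bhattacharyya (p.mix (checkPow a)) ≤ bhattacharyya (p.mix (checkPow b)) := by
  rw [p.bhattacharyya_mix ha.checkPow, p.bhattacharyya_mix hb.checkPow]
  exact Finset.sum_le_sum fun n _ => mul_le_mul_of_nonneg_left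
    (bhattacharyya_le_of_evenMoment_le (ha.checkPow n) (hb.checkPow n) (evenMoment_checkPow_le h n))
    (p.coeff_nonneg n)

theorem DegreeDistribution.bhattacharyya_mix_checkPow_sub_le (p : DegreeDistribution)
    (ha : IsLDensity a) (hb : IsLDensity b) (h : evenMoment b ≤ evenMoment a) :
    bhattacharyya (p.mix (checkPow b)) - bhattacharyya (p.mix (checkPow a)) ≤
      p.poly.derivative.eval (1 - bhattacharyya a ^ 2) * (bhattacharyya b - bhattacharyya a) := by
  rw [p.bhattacharyya_mix ha.checkPow, p.bhattacharyya_mix hb.checkPow, ← Finset.sum_sub_distrib,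
    p.eval_derivative, Finset.sum_mul]
  refine Finset.sum_le_sum fun n _ => ?_
  rw [← mul_sub, mul_assoc]
  exact mul_le_mul_of_nonneg_left (bhattacharyya_checkPow_sub_le ha hb h n) (p.coeff_nonneg n)

theorem bhattacharyya_densityEvolution_sub_le (lam rho : DegreeDistribution) (hc : IsLDensity c)
    (ha : IsLDensity a) (hb : IsLDensity b) (h : evenMoment b ≤ evenMoment a) :
    bhattacharyya (densityEvolution lam rho c b) - bhattacharyya (densityEvolution lam rho c a) ≤
      uniquenessFactor lam rho c a * (bhattacharyya b - bhattacharyya a) := by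
  have hlam := lam.eval_sub_le (bhattacharyya_nonneg _)
    (rho.bhattacharyya_mix_checkPow_le ha hb h)
    (rho.isLDensity_mix hb.checkPow).bhattacharyya_le_one
  have hrho := rho.bhattacharyya_mix_checkPow_sub_le ha hb h
  rw [hc.bhattacharyya_densityEvolution lam rho hb, hc.bhattacharyya_densityEvolution lam rho ha,
    ← mul_sub, uniquenessFactor, mul_assoc, mul_assoc]
  exact mul_le_mul_of_nonneg_left
    (hlam.trans (mul_le_mul_of_nonneg_left hrho (lam.eval_derivative_nonneg zero_le_one)))
    (bhattacharyya_nonneg c)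

/-! ### Convergence to the BP fixed point -/

theorem integral_eval_tanhHalf (a : ProbabilityMeasure EReal) (p : Polynomial ℝ) :
    ∫ x, p.eval (tanhHalf x) ∂a =
      ∑ n ∈ Finset.range (p.natDegree + 1), p.coeff n * ∫ x, tanhHalf x ^ n ∂a := by
  simp only [Polynomial.eval_eq_sum_range]
  rw [integral_finsetSum _ fun n _ => (integrable_tanhHalf_pow a n).const_mul _]
  simp only [integral_const_mul]

theorem tendsto_of_tendsto_integral_tanhHalf_pow {ι : Type*} {l : Filter ι}
    {x : ι → ProbabilityMeasure EReal}
    (h : ∀ n : ℕ, Tendsto (fun i => ∫ y, tanhHalf y ^ n ∂(x i)) l (𝓝 (∫ y, tanhHalf y ^ n ∂a))) :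
    Tendsto x l (𝓝 a) := by
  let T : BoundedContinuousFunction EReal ℝ := .mkOfCompact ⟨tanhHalf, continuous_tanhHalf⟩
  let A : StarSubalgebra ℝ (BoundedContinuousFunction EReal ℝ) :=
    { Algebra.adjoin ℝ {T} with star_mem' := id }
  have hT : T ∈ A := Algebra.self_mem_adjoin_singleton ℝ T
  refine ProbabilityMeasure.tendsto_of_tight_of_separatesPoints ℝ (A := A) .of_compactSpace ?_ ?_
  · intro y z hyz
    refine ⟨T, ⟨_, ⟨T, hT, rfl⟩, rfl⟩, ?_⟩
    exact (Function.LeftInverse.injective twoArtanh_tanhHalf).ne hyz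
  · intro g hg
    obtain ⟨p, rfl⟩ := Algebra.adjoin_mem_exists_aeval ℝ T hg
    have heval : ∀ y, Polynomial.aeval T p y = p.eval (tanhHalf y) := fun y => by
      clear hg
      induction p using Polynomial.induction_on' with
      | add p q hp hq => simp [hp, hq]
      | monomial n r => simp [Polynomial.aeval_monomial, T]
    simp only [heval, integral_eval_tanhHalf]
    exact tendsto_finsetSum _ fun n _ => (h n).const_mul _

theorem tendsto_of_tendsto_evenMoment {ι : Type*} {l : Filter ι}
    {x : ι → ProbabilityMeasure EReal} (hx : ∀ i, IsLDensity (x i)) (ha : IsLDensity a)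
    (h : ∀ k, Tendsto (fun i => evenMoment (x i) k) l (𝓝 (evenMoment a k))) :
    Tendsto x l (𝓝 a) :=
  tendsto_of_tendsto_integral_tanhHalf_pow fun n => by
    obtain ⟨k, rfl | rfl⟩ := n.even_or_odd'
    · exact h k
    · simpa only [(hx _).integral_tanhHalf_pow_odd, ha.integral_tanhHalf_pow_odd] using h (k + 1)

theorem sqrtCoeff_mul_evenMoment_sub_le (ha : IsLDensity a) (hb : IsLDensity b)
    (h : evenMoment b ≤ evenMoment a) (k : ℕ) :
    sqrtCoeff k * (evenMoment a (k + 1) - evenMoment b (k + 1)) ≤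
      bhattacharyya b - bhattacharyya a := by
  have hdiff := ha.hasSum_evenMoment.sub hb.hasSum_evenMoment
  simp only [← mul_sub, sub_sub_sub_cancel_left] at hdiff
  exact le_hasSum hdiff k fun j _ =>
    mul_nonneg (sqrtCoeff_pos j).le (sub_nonneg.2 (h (j + 1)))

theorem tendsto_evenMoment_of_tendsto_bhattacharyya {ι : Type*} {l : Filter ι}
    {x : ι → ProbabilityMeasure EReal} (hx : ∀ i, IsLDensity (x i)) (ha : IsLDensity a)
    (hle : ∀ i, evenMoment (x i) ≤ evenMoment a)
    (h : Tendsto (fun i => bhattacharyya (x i)) l (𝓝 (bhattacharyya a))) (k : ℕ) :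
    Tendsto (fun i => evenMoment (x i) k) l (𝓝 (evenMoment a k)) := by
  rcases k with _ | k
  · simpa only [evenMoment_zero] using tendsto_const_nhds
  have hlower : Tendsto (fun i => evenMoment a (k + 1) -
      (bhattacharyya (x i) - bhattacharyya a) / sqrtCoeff k) l (𝓝 (evenMoment a (k + 1))) := by
    simpa using ((h.sub_const (bhattacharyya a)).div_const (sqrtCoeff k)).const_sub
      (evenMoment a (k + 1))
  refine tendsto_of_tendsto_of_tendsto_of_le_of_le hlower tendsto_const_nhds (fun i => ?_)
    fun i => hle i (k + 1)
  have := (le_div_iff₀' (sqrtCoeff_pos k)).2 (sqrtCoeff_mul_evenMoment_sub_le ha (hx i) (hle i) k)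
  linarith

/-- The density after `l` iterations of density evolution from the useless density, as in
`IsBPFixedPoint`. -/
def bpIterate (lam rho : DegreeDistribution) (c : ProbabilityMeasure EReal) (l : ℕ) :
    ProbabilityMeasure EReal :=
  (densityEvolution lam rho c)^[l] (unitMass 0)

theorem bpIterate_succ (lam rho : DegreeDistribution) (c : ProbabilityMeasure EReal) (l : ℕ) :
    bpIterate lam rho c (l + 1) = densityEvolution lam rho c (bpIterate lam rho c l) :=
  Function.iterate_succ_apply' _ _ _

theorem isLDensity_bpIterate (lam rho : DegreeDistribution) (hc : IsLDensity c) (l : ℕ) :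
    IsLDensity (bpIterate lam rho c l) := by
  induction l with
  | zero => exact isLDensity_unitMass_zero
  | succ l ih => exact bpIterate_succ lam rho c l ▸ hc.densityEvolution lam rho ih

section FixedPoint

variable {lam rho : DegreeDistribution} {c' f f' : ProbabilityMeasure EReal}

theorem IsFixedPointDensity.overlapLE_bpIterate (hc : IsLDensity c) (hc' : IsLDensity c')
    (hcc' : OverlapLE c c') (hf : IsFixedPointDensity lam rho c f) (l : ℕ) :
    OverlapLE f (bpIterate lam rho c' l) := by
  induction l with
  | zero => exact overlapLE_unitMass_zero hf.isLDensity
  | succ l ih =>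
    have hstep := OverlapLE.densityEvolution lam rho hc hc' hf.isLDensity
      (isLDensity_bpIterate lam rho hc' l) hcc' ih
    rwa [hf.fixed, ← bpIterate_succ] at hstep

theorem IsFixedPointDensity.evenMoment_bpIterate_le (hc : IsLDensity c) (hc' : IsLDensity c')
    (hcc' : OverlapLE c c') (hf : IsFixedPointDensity lam rho c f) (l : ℕ) :
    evenMoment (bpIterate lam rho c' l) ≤ evenMoment f :=
  (hf.overlapLE_bpIterate hc hc' hcc' l).evenMoment_le hf.isLDensity
    (isLDensity_bpIterate lam rho hc' l)

theorem IsFixedPointDensity.bhattacharyya_bpIterate_sub_le (hc : IsLDensity c)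
    (hf : IsFixedPointDensity lam rho c f) (l : ℕ) :
    bhattacharyya (bpIterate lam rho c l) - bhattacharyya f ≤ uniquenessFactor lam rho c f ^ l := by
  induction l with
  | zero =>
    have := (isLDensity_bpIterate lam rho hc 0).bhattacharyya_le_one
    linarith [bhattacharyya_nonneg f]
  | succ l ih =>
    calc bhattacharyya (bpIterate lam rho c (l + 1)) - bhattacharyya f
        ≤ uniquenessFactor lam rho c f *
            (bhattacharyya (bpIterate lam rho c l) - bhattacharyya f) := by
          have hstep := bhattacharyya_densityEvolution_sub_le lam rho hc hf.isLDensity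
            (isLDensity_bpIterate lam rho hc l) (hf.evenMoment_bpIterate_le hc hc (.refl c) l)
          rwa [hf.fixed, ← bpIterate_succ] at hstep
      _ ≤ uniquenessFactor lam rho c f ^ (l + 1) := by
          rw [pow_succ']
          exact mul_le_mul_of_nonneg_left ih (uniquenessFactor_nonneg lam rho c hf.isLDensity)

theorem IsFixedPointDensity.tendsto_bhattacharyya (hc : IsLDensity c)
    (hf : IsFixedPointDensity lam rho c f) (hq : uniquenessFactor lam rho c f < 1) :
    Tendsto (fun l => bhattacharyya (bpIterate lam rho c l)) atTop (𝓝 (bhattacharyya f)) := by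
  have hupper : Tendsto (fun l => bhattacharyya f + uniquenessFactor lam rho c f ^ l) atTop
      (𝓝 (bhattacharyya f)) := by
    simpa using (tendsto_pow_atTop_nhds_zero_of_lt_one
      (uniquenessFactor_nonneg lam rho c hf.isLDensity) hq).const_add (bhattacharyya f)
  exact tendsto_of_tendsto_of_tendsto_of_le_of_le tendsto_const_nhds hupper
    (fun l => bhattacharyya_le_of_evenMoment_le hf.isLDensity (isLDensity_bpIterate lam rho hc l)
      (hf.evenMoment_bpIterate_le hc hc (.refl c) l))
    fun l => sub_le_iff_le_add'.1 (hf.bhattacharyya_bpIterate_sub_le hc l)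

theorem IsFixedPointDensity.tendsto_evenMoment (hc : IsLDensity c)
    (hf : IsFixedPointDensity lam rho c f) (hq : uniquenessFactor lam rho c f < 1) (k : ℕ) :
    Tendsto (fun l => evenMoment (bpIterate lam rho c l) k) atTop (𝓝 (evenMoment f k)) :=
  tendsto_evenMoment_of_tendsto_bhattacharyya (isLDensity_bpIterate lam rho hc) hf.isLDensity
    (hf.evenMoment_bpIterate_le hc hc (.refl c)) (hf.tendsto_bhattacharyya hc hq) k

theorem IsFixedPointDensity.isBPFixedPoint (hc : IsLDensity c)
    (hf : IsFixedPointDensity lam rho c f) (hq : uniquenessFactor lam rho c f < 1) :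
    IsBPFixedPoint lam rho c f :=
  tendsto_of_tendsto_evenMoment (isLDensity_bpIterate lam rho hc) hf.isLDensity
    (hf.tendsto_evenMoment hc hq)

theorem IsFixedPointDensity.evenMoment_le (hc : IsLDensity c) (hc' : IsLDensity c')
    (hcc' : OverlapLE c c') (hf : IsFixedPointDensity lam rho c f)
    (hf' : IsFixedPointDensity lam rho c' f') (hq' : uniquenessFactor lam rho c' f' < 1) :
    evenMoment f' ≤ evenMoment f := fun k =>
  le_of_tendsto' (hf'.tendsto_evenMoment hc' hq' k)
    fun l => hf.evenMoment_bpIterate_le hc hc' hcc' l k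

/-- Passing from `f` to `f'` first changes the density, at the cost of the contraction factor, and
then the channel, at the cost of `B(c') - B(c)` times a value of `λ` in `[0, 1]`. -/
theorem IsFixedPointDensity.one_sub_mul_bhattacharyya_sub_le (hc : IsLDensity c)
    (hc' : IsLDensity c') (hcc' : OverlapLE c c') (hf : IsFixedPointDensity lam rho c f)
    (hf' : IsFixedPointDensity lam rho c' f') (hq' : uniquenessFactor lam rho c' f' < 1) :
    (1 - uniquenessFactor lam rho c f) * (bhattacharyya f' - bhattacharyya f) ≤
      bhattacharyya c' - bhattacharyya c := by
  have hdensity := bhattacharyya_densityEvolution_sub_le lam rho hc hf.isLDensity hf'.isLDensity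
    (hf.evenMoment_le hc hc' hcc' hf' hq')
  have hlam := lam.eval_le_one (bhattacharyya_nonneg (rho.mix (checkPow f')))
    (rho.isLDensity_mix hf'.isLDensity.checkPow).bhattacharyya_le_one
  have hchannel : bhattacharyya f' - bhattacharyya (densityEvolution lam rho c f') ≤
      bhattacharyya c' - bhattacharyya c := by
    have hc_le := bhattacharyya_le_of_evenMoment_le hc hc' (hcc'.evenMoment_le hc hc')
    nth_rw 1 [← hf'.fixed]
    rw [hc.bhattacharyya_densityEvolution lam rho hf'.isLDensity,
      hc'.bhattacharyya_densityEvolution lam rho hf'.isLDensity, ← sub_mul]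
    exact mul_le_of_le_one_right (sub_nonneg.2 hc_le) hlam
  rw [hf.fixed] at hdensity
  linarith

theorem IsFixedPointDensity.abs_bhattacharyya_sub_le (hc : IsLDensity c) (hc' : IsLDensity c')
    (hcc' : OverlapLE c c') (hf : IsFixedPointDensity lam rho c f)
    (hf' : IsFixedPointDensity lam rho c' f') {δ : ℝ} (hδ : 0 < δ)
    (hq : uniquenessFactor lam rho c f ≤ 1 - δ) (hq' : uniquenessFactor lam rho c' f' < 1) :
    |bhattacharyya f - bhattacharyya f'| ≤ δ⁻¹ * |bhattacharyya c - bhattacharyya c'| := by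
  have hc_le := bhattacharyya_le_of_evenMoment_le hc hc' (hcc'.evenMoment_le hc hc')
  have hf_le := bhattacharyya_le_of_evenMoment_le hf.isLDensity hf'.isLDensity
    (hf.evenMoment_le hc hc' hcc' hf' hq')
  rw [abs_sub_comm, abs_of_nonneg (sub_nonneg.2 hf_le), abs_sub_comm,
    abs_of_nonneg (sub_nonneg.2 hc_le), le_inv_mul_iff₀ hδ]
  exact (mul_le_mul_of_nonneg_right (le_sub_comm.1 hq) (sub_nonneg.2 hf_le)).trans
    (hf.one_sub_mul_bhattacharyya_sub_le hc hc' hcc' hf' hq')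

end FixedPoint

end

theorem mainTheorem11 (lam rho : DegreeDistribution) :
    (∀ (I : Set ℝ) (c : ℝ → ProbabilityMeasure EReal), IsDegradedFamily I c → ∀ h ∈ I,
      (∀ f f' : ProbabilityMeasure EReal,
        IsFixedPointDensity lam rho (c h) f → uniquenessFactor lam rho (c h) f < 1 →
        IsFixedPointDensity lam rho (c h) f' → uniquenessFactor lam rho (c h) f' < 1 →
        f = f') ∧
      (∀ f : ProbabilityMeasure EReal,
        IsFixedPointDensity lam rho (c h) f → uniquenessFactor lam rho (c h) f < 1 →
        IsBPFixedPoint lam rho (c h) f)) ∧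
    (∀ δ : ℝ, 0 < δ → ∃ C : ℝ,
      ∀ (I : Set ℝ) (c : ℝ → ProbabilityMeasure EReal), IsDegradedFamily I c →
      ∀ h₁ ∈ I, ∀ h₂ ∈ I, ∀ f₁ f₂ : ProbabilityMeasure EReal,
        IsFixedPointDensity lam rho (c h₁) f₁ → uniquenessFactor lam rho (c h₁) f₁ ≤ 1 - δ →
        IsFixedPointDensity lam rho (c h₂) f₂ → uniquenessFactor lam rho (c h₂) f₂ ≤ 1 - δ →
        |bhattacharyya f₁ - bhattacharyya f₂|
          ≤ C * |bhattacharyya (c h₁) - bhattacharyya (c h₂)|) := by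
  refine ⟨fun I c hI h hh => ?_, fun δ hδ => ⟨δ⁻¹, ?_⟩⟩
  · have hc := hI.isLDensity h hh
    exact ⟨fun f f' hf hq hf' hq' =>
        tendsto_nhds_unique (hf.isBPFixedPoint hc hq) (hf'.isBPFixedPoint hc hq'),
      fun f hf hq => hf.isBPFixedPoint hc hq⟩
  · intro I c hI h₁ hh₁ h₂ hh₂ f₁ f₂ hf₁ hq₁ hf₂ hq₂
    have hc₁ := hI.isLDensity h₁ hh₁
    have hc₂ := hI.isLDensity h₂ hh₂
    rcases le_total h₁ h₂ with hle | hle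
    · exact hf₁.abs_bhattacharyya_sub_le hc₁ hc₂
        (hI.degraded h₁ hh₁ h₂ hh₂ hle).overlapLE hf₂ hδ hq₁ (by linarith)
    · rw [abs_sub_comm, abs_sub_comm (bhattacharyya (c h₁))]
      exact hf₂.abs_bhattacharyya_sub_le hc₂ hc₁
        (hI.degraded h₂ hh₂ h₁ hh₁ hle).overlapLE hf₁ hδ hq₂ (by linarith)
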